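/- **Setting.** Let $(M_p)_{p\in\mathbb N}$ be a sequence of positive numbers with $M_0=1$ satisfying - (M.1) $M_p^2\le M_{p-1}M_{p+1}$ for $p\ge 1$; - (M.2) $M_p\le c_0H^p\min_{0\le q\le p}M_{p-q}M_q$ for $p\ge 0$, for some $c_0,H\ge 1$; - (M.3) $\sum_{j\ge p+1}M_{j-1}/M_j\le c_0\,p\,M_p/M_{p+1}<\infty$ for $p\ge 1$, for some $c_0\ge1$. Let $\mathfrak R$ be the set of positive, monotonically increasing sequences $(r_i)_{i\ge1}$ with $r_i\to\infty$. For $(r_i)\in\mathfrak R$ put $N_{(r_i)}(\rho)=\sup_{p\ge 0}\ln_+\frac{\rho^p}{M_p\prod_{i=1}^pr_i}$, $\rho>0$, and, for a smooth function $f$ on an open set $\Omega\subseteq\mathbb R^d$ and a compact set $K\subset\Omega$, $$\|f\|_{K,(r_i)}=\sup_{x\in K,\ \alpha\in\mathbb N^d}\frac{|f^{(\alpha)}(x)|}{M_{|\alpha|}\prod_{i\le|\alpha|}r_i}.$$ The space $\mathcal E^{\{M_p\}}(\Omega)$ of Roumieu ultradifferentiable functions consists of all $f\in C^\infty(\Omega)$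 with $\|f\|_{K,(r_i)}<\infty$ for all compact $K\subset\Omega$ and all $(r_i)\in\mathfrak R$. The space $\mathcal D^{\{M_p\}}(K)$ consists of the smooth $\phi$ with support in $K$ and $\|\phi\|_{K,(r_i)}<\infty$ for all $(r_i)\in\mathfrak R$, with the topology of these norms; $\mathcal D^{\{M_p\}}(\Omega)$ is the locally convex inductive limit of the $\mathcal D^{\{M_p\}}(K)$, $K\subset\Omega$ compact. A Roumieu ultradistribution $T\in\mathcal D'^{\{M_p\}}(\Omega)$ is a continuous linear functional on $\mathcal D^{\{M_p\}}(\Omega)$. For nets indexed by $\varepsilon\in(0,1)$, $O$-estimates are meant as $\varepsilon\to0$. Let $\mathcal E_M^{\{M_p\}}(\Omega)$ be the space of nets $(g_\varepsilon)$ in $\mathcal E^{\{M_p\}}(\Omega)$ such that for all compact $K\subset\Omega$ and all $(h_i)\in\mathfrak R$ there is $(k_i)\in\mathfrak R$ with $\|g_\varepsilon\|_{K,(h_i)}=O(e^{N_{(k_i)}(1/\varepsilon)})$, let $\mathcal N^{\{M_p\}}(\Omega)$ be the space of those nets with $\|g_\varepsilon\|_{K,(h_i)}=O(e^{-N_{(k_i)}(1/\varepsilon)})$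 for all compact $K\subset\Omega$ and all $(h_i),(k_i)\in\mathfrak R$, and let $\mathcal G^{\{M_p\}}(\Omega)=\mathcal E_M^{\{M_p\}}(\Omega)/\mathcal N^{\{M_p\}}(\Omega)$; write $[(g_\varepsilon)]$ for the class of $(g_\varepsilon)$. **Theorem.** Let $g\in\mathcal G^{\{M_p\}}(\Omega)$ and $T\in\mathcal D'^{\{M_p\}}(\Omega)$, and suppose that to every compact set $K\subset\Omega$ there are associated sequences $(k_i)=(k_i^K)$ and $(b_i)=(b_i^K)$ in $\mathfrak R$ such that: 1. ($g\in\mathcal G^{\infty,\{M_p\}}(\Omega)$, i.e. $g$ is a regular generalized Roumieu ultradistribution, with sequences $(k_i)$) $g$ has a representative $(g_\varepsilon)$ such that for every compact $K\subset\Omega$ and every $(h_i)\in\mathfrak R$, $\|g_\varepsilon\|_{K,(h_i)}=O(e^{N_{(k_i)}(1/\varepsilon)})$; 2. ($g$ is strongly $R$-associated to $T$ with sequences $(b_i)$) $g$ has a representative $(g_\varepsilon)$ such that for every compact $K\subset\Omega$ there are $(\ell_i)\in\mathfrak R$, $C>0$ and $\varepsilon_0\in(0,1)$ with $$\Big|\int_\Omega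 g_\varepsilon\phi\,dx-\langle T,\phi\rangle\Big|\le C\,e^{-N_{(b_i)}(1/\varepsilon)}\,\|\phi\|_{K,(\ell_i)}\qquad\text{for all }\phi\in\mathcal D^{\{M_p\}}(K),\ \varepsilon\in(0,\varepsilon_0);$$ 3. $b_i\le k_i$ for all $i$ and every compact $K\subset\Omega$. Then $T\in\mathcal E^{\{M_p\}}(\Omega)$, i.e. there is a Roumieu ultradifferentiable function $f\in\mathcal E^{\{M_p\}}(\Omega)$ with $\langle T,\phi\rangle=\int_\Omega f\phi\,dx$ for all $\phi\in\mathcal D^{\{M_p\}}(\Omega)$. -/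

import Mathlib

open scoped ENNReal ContDiff

noncomputable section

namespace Roumieu

/-- The space `ℝ^d` with its Euclidean norm and Lebesgue measure. -/
abbrev Space (d : ℕ) := EuclideanSpace ℝ (Fin d)

/-- A weight sequence `(M_p)`: positive, `M_0 = 1`, with the conditions (M.1), (M.2), (M.3). -/
structure WeightSequence where
  /-- The terms `M_p`. -/
  toFun : ℕ → ℝ
  pos : ∀ p, 0 < toFun p
  zero : toFun 0 = 1
  /-- (M.1): `M_p ^ 2 ≤ M_{p-1} M_{p+1}` for `p ≥ 1`. -/
  logConvex : ∀ p, toFun (p + 1) ^ 2 ≤ toFun p * toFun (p + 2)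
  /-- (M.2): `M_p ≤ c₀ H ^ p min_{q ≤ p} M_{p-q} M_q`. -/
  stable : ∃ c₀ H : ℝ, 1 ≤ c₀ ∧ 1 ≤ H ∧
    ∀ p q, q ≤ p → toFun p ≤ c₀ * H ^ p * (toFun (p - q) * toFun q)
  /-- (M.3): `∑_{j ≥ p+1} M_{j-1} / M_j` converges and is at most `c₀ p M_p / M_{p+1}`
  for `p ≥ 1`. -/
  strongNonQuasianalytic : ∃ c₀ : ℝ, 1 ≤ c₀ ∧
    Summable (fun j => toFun j / toFun (j + 1)) ∧
    ∀ p : ℕ, 1 ≤ p → ∑' j, toFun (p + j) / toFun (p + j + 1) ≤ c₀ * p * (toFun p / toFun (p + 1))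

instance : CoeFun WeightSequence (fun _ => ℕ → ℝ) := ⟨WeightSequence.toFun⟩

/-- The set `𝓡` of positive monotonically increasing sequences tending to infinity. Sequences
`(r_1, r_2, …)` are indexed from `0` in the code: `r i` is the term `r_{i+1}`. -/
def seqR : Set (ℕ → ℝ) :=
  {r | (∀ i, 0 < r i) ∧ Monotone r ∧ Filter.Tendsto r Filter.atTop Filter.atTop}

/-- The sequence `N_p = M_p ∏_{i=1}^p r_i`. -/
def weighted (M : WeightSequence) (r : ℕ → ℝ) (p : ℕ) : ℝ :=
  M p * ∏ i ∈ Finset.range p, r i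

/-- The associated function `N_{(r_i)}(ρ) = sup_p ln₊ (ρ ^ p / N_p)`. The supremum is finite for
`(r_i) ∈ 𝓡` by `bddAbove_assoc`. -/
def assocFun (M : WeightSequence) (r : ℕ → ℝ) (ρ : ℝ) : ℝ :=
  ⨆ p : ℕ, Real.posLog (ρ ^ p / weighted M r p)

section Aux

theorem weighted_pos (M : WeightSequence) {r : ℕ → ℝ} (hr : r ∈ seqR) (p : ℕ) :
    0 < weighted M r p :=
  mul_pos (M.pos p) (Finset.prod_pos fun i _ => hr.1 i)

theorem bddAbove_assoc (M : WeightSequence) {r : ℕ → ℝ} (hr : r ∈ seqR) {ρ : ℝ} (hρ : 0 < ρ) :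
    BddAbove (Set.range fun p : ℕ => Real.posLog (ρ ^ p / weighted M r p)) := by
  obtain ⟨c, hc, hs, -⟩ := M.strongNonQuasianalytic
  have hpos : ∀ p, 0 < ρ ^ p / weighted M r p := fun p =>
    div_pos (pow_pos hρ p) (weighted_pos M hr p)
  -- the ratio of consecutive terms tends to zero
  have h1 : ∀ᶠ p in Filter.atTop, M p / M (p + 1) < ρ⁻¹ :=
    hs.tendsto_atTop_zero.eventually_lt_const (inv_pos.2 hρ)
  have h2 : ∀ᶠ p in Filter.atTop, 1 ≤ r p := hr.2.2.eventually_ge_atTop 1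
  obtain ⟨P, hP⟩ := Filter.eventually_atTop.1 (h1.and h2)
  have hstep : ∀ p, P ≤ p →
      ρ ^ (p + 1) / weighted M r (p + 1) ≤ ρ ^ p / weighted M r p := by
    intro p hp
    obtain ⟨ha, hb⟩ := hP p hp
    have hM := M.pos p
    have hM' := M.pos (p + 1)
    have hQ : 0 < ∏ i ∈ Finset.range p, r i := Finset.prod_pos fun i _ => hr.1 i
    have h3 : ρ * M p ≤ M (p + 1) := by
      rw [div_lt_iff₀ hM', inv_mul_eq_div, lt_div_iff₀ hρ] at ha
      linarith
    rw [div_le_div_iff₀ (weighted_pos M hr _) (weighted_pos M hr _)]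
    unfold weighted
    rw [Finset.prod_range_succ, pow_succ]
    have h4 : ρ * M p ≤ M (p + 1) * r p := h3.trans (le_mul_of_one_le_right hM'.le hb)
    have h5 : 0 ≤ ρ ^ p * ∏ i ∈ Finset.range p, r i := by positivity
    nlinarith [mul_le_mul_of_nonneg_left h4 h5]
  have hle : ∀ n, ρ ^ (P + n) / weighted M r (P + n) ≤ ρ ^ P / weighted M r P := by
    intro n
    induction n with
    | zero => simp
    | succ n ih => exact (hstep (P + n) (by omega)).trans ih
  refine ⟨∑ p ∈ Finset.range (P + 1), Real.posLog (ρ ^ p / weighted M r p), ?_⟩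
  rintro _ ⟨p, rfl⟩
  have hsum : ∀ q ∈ Finset.range (P + 1), Real.posLog (ρ ^ q / weighted M r q) ≤
      ∑ p ∈ Finset.range (P + 1), Real.posLog (ρ ^ p / weighted M r p) := fun q hq =>
    Finset.single_le_sum (f := fun p => Real.posLog (ρ ^ p / weighted M r p))
      (fun _ _ => Real.posLog_nonneg) hq
  rcases le_total p P with h | h
  · exact hsum p (Finset.mem_range.2 (by omega))
  · obtain ⟨n, rfl⟩ := Nat.exists_eq_add_of_le h
    exact (Real.posLog_le_posLog (hpos _).le (hle n)).trans
      (hsum P (Finset.mem_range.2 (by omega)))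

theorem assocFun_anti (M : WeightSequence) {r s : ℕ → ℝ} (hr : r ∈ seqR) (hs : s ∈ seqR)
    (hrs : r ≤ s) {ρ : ℝ} (hρ : 0 < ρ) : assocFun M s ρ ≤ assocFun M r ρ := by
  refine ciSup_mono (bddAbove_assoc M hr hρ) fun p => ?_
  refine Real.posLog_le_posLog (div_pos (pow_pos hρ p) (weighted_pos M hs p)).le ?_
  refine div_le_div_of_nonneg_left (pow_pos hρ p).le (weighted_pos M hr p) ?_
  exact mul_le_mul_of_nonneg_left
    (Finset.prod_le_prod (fun i _ => (hr.1 i).le) fun i _ => hrs i) (M.pos p).le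

theorem inf_mem_seqR {r s : ℕ → ℝ} (hr : r ∈ seqR) (hs : s ∈ seqR) : r ⊓ s ∈ seqR := by
  refine ⟨fun i => lt_min (hr.1 i) (hs.1 i), hr.2.1.inf hs.2.1, ?_⟩
  refine Filter.tendsto_atTop.2 fun b => ?_
  filter_upwards [hr.2.2.eventually_ge_atTop b, hs.2.2.eventually_ge_atTop b] with i h1 h2
  exact le_min h1 h2

theorem id_mem_seqR : (fun i : ℕ => (i : ℝ) + 1) ∈ seqR :=
  ⟨fun i => by positivity, fun i j h => by simpa using h,
    Filter.tendsto_atTop_add_const_right _ _ tendsto_natCast_atTop_atTop⟩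

end Aux

variable {d : ℕ}

/-- The partial derivative `f^{(α)}(x)`: the derivative of order `|α|` of `f` at `x`, evaluated on
the list of directions in which the `i`-th basis vector occurs `α i` times. -/
def partialDeriv (α : Fin d → ℕ) (f : Space d → ℂ) (x : Space d) : ℂ :=
  iteratedFDeriv ℝ (∑ i, α i) f x
    (fun j => EuclideanSpace.basisFun (Fin d) ℝ (finSigmaFinEquiv.symm j).1)

/-- `‖f‖_{K,(r_i)} = sup_{x ∈ K, α} |f^{(α)}(x)| / (M_{|α|} ∏_{i ≤ |α|} r_i)`, in `[0, ∞]`. -/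
def ultraNorm (M : WeightSequence) (K : Set (Space d)) (r : ℕ → ℝ) (f : Space d → ℂ) : ℝ≥0∞ :=
  ⨆ x ∈ K, ⨆ α : Fin d → ℕ, ENNReal.ofReal (‖partialDeriv α f x‖ / weighted M r (∑ i, α i))

section Aux

theorem ultraNorm_add_le (M : WeightSequence) {K : Set (Space d)} {r : ℕ → ℝ} (hr : r ∈ seqR)
    {f g : Space d → ℂ} (hf : ∀ x ∈ K, ContDiffAt ℝ ∞ f x) (hg : ∀ x ∈ K, ContDiffAt ℝ ∞ g x) :
    ultraNorm M K r (f + g) ≤ ultraNorm M K r f + ultraNorm M K r g := by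
  refine iSup₂_le fun x hx => iSup_le fun α => ?_
  have hN := weighted_pos M hr (∑ i, α i)
  have h : partialDeriv α (f + g) x = partialDeriv α f x + partialDeriv α g x := by
    unfold partialDeriv
    rw [iteratedFDeriv_add_apply ((hf x hx).of_le (by exact_mod_cast le_top))
      ((hg x hx).of_le (by exact_mod_cast le_top))]
    rfl
  calc _ ≤ ENNReal.ofReal (‖partialDeriv α f x‖ / weighted M r (∑ i, α i)
        + ‖partialDeriv α g x‖ / weighted M r (∑ i, α i)) := by
        refine ENNReal.ofReal_le_ofReal ?_
        rw [h, ← add_div]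
        exact div_le_div_of_nonneg_right (norm_add_le _ _) hN.le
    _ ≤ _ := ENNReal.ofReal_add_le
    _ ≤ _ := add_le_add
        (le_iSup₂_of_le x hx (le_iSup (fun α : Fin d → ℕ =>
          ENNReal.ofReal (‖partialDeriv α f x‖ / weighted M r (∑ i, α i))) α))
        (le_iSup₂_of_le x hx (le_iSup (fun α : Fin d → ℕ =>
          ENNReal.ofReal (‖partialDeriv α g x‖ / weighted M r (∑ i, α i))) α))

theorem ultraNorm_smul_le (M : WeightSequence) {K : Set (Space d)} {r : ℕ → ℝ}
    (c : ℂ) {f : Space d → ℂ} (hf : ∀ x ∈ K, ContDiffAt ℝ ∞ f x) :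
    ultraNorm M K r (c • f) ≤ ENNReal.ofReal ‖c‖ * ultraNorm M K r f := by
  refine iSup₂_le fun x hx => iSup_le fun α => ?_
  have h : partialDeriv α (c • f) x = c * partialDeriv α f x := by
    unfold partialDeriv
    rw [iteratedFDeriv_const_smul_apply ((hf x hx).of_le (by exact_mod_cast le_top))]
    rfl
  rw [h, norm_mul, mul_div_assoc, ENNReal.ofReal_mul (norm_nonneg c)]
  gcongr
  exact le_iSup₂_of_le x hx (le_iSup (fun α : Fin d → ℕ =>
          ENNReal.ofReal (‖partialDeriv α f x‖ / weighted M r (∑ i, α i))) α)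

theorem ultraNorm_zero (M : WeightSequence) (K : Set (Space d)) (r : ℕ → ℝ) :
    ultraNorm M K r 0 = 0 := by
  simp [ultraNorm, partialDeriv]

theorem ultraNorm_le_of_tsupport_subset (M : WeightSequence) {K L : Set (Space d)} (r : ℕ → ℝ)
    {f : Space d → ℂ} (hf : tsupport f ⊆ K) : ultraNorm M L r f ≤ ultraNorm M K r f := by
  refine iSup₂_le fun x _ => iSup_le fun α => ?_
  by_cases hx : x ∈ K
  · exact le_iSup₂_of_le x hx (le_iSup (fun α : Fin d → ℕ =>
          ENNReal.ofReal (‖partialDeriv α f x‖ / weighted M r (∑ i, α i))) α)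
  · have h0 : iteratedFDeriv ℝ (∑ i, α i) f x = 0 := by
      by_contra hne
      exact hx (hf (support_iteratedFDeriv_subset (𝕜 := ℝ) (∑ i, α i) hne))
    simp [partialDeriv, h0]

end Aux

/-- The space `𝓔^{{M_p}}(Ω)` of Roumieu ultradifferentiable functions: smooth functions on `Ω` with
`‖f‖_{K,(r_i)} < ∞` for all compact `K ⊆ Ω` and all `(r_i) ∈ 𝓡`. Functions are total in the code;
only their values on `Ω` are constrained or used. -/
def ultraDiff (M : WeightSequence) (Ω : TopologicalSpace.Opens (Space d)) :
    Submodule ℂ (Space d → ℂ) where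
  carrier := {f | ContDiffOn ℝ ∞ f Ω ∧
    ∀ K : Set (Space d), IsCompact K → K ⊆ Ω → ∀ r ∈ seqR, ultraNorm M K r f < ⊤}
  add_mem' {f g} hf hg := by
    refine ⟨hf.1.add hg.1, fun K hK hKΩ r hr => ?_⟩
    exact (ultraNorm_add_le M hr
      (fun x hx => hf.1.contDiffAt (Ω.isOpen.mem_nhds (hKΩ hx)))
      (fun x hx => hg.1.contDiffAt (Ω.isOpen.mem_nhds (hKΩ hx)))).trans_lt
      (ENNReal.add_lt_top.2 ⟨hf.2 K hK hKΩ r hr, hg.2 K hK hKΩ r hr⟩)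
  zero_mem' := ⟨contDiffOn_const, fun K _ _ r _ => by simp [ultraNorm_zero]⟩
  smul_mem' c f hf := by
    refine ⟨hf.1.const_smul c, fun K hK hKΩ r hr => ?_⟩
    exact (ultraNorm_smul_le M c
      (fun x hx => hf.1.contDiffAt (Ω.isOpen.mem_nhds (hKΩ hx)))).trans_lt
      (ENNReal.mul_lt_top ENNReal.ofReal_lt_top (hf.2 K hK hKΩ r hr))

theorem ultraDiff_contDiffAt {M : WeightSequence} {Ω : TopologicalSpace.Opens (Space d)}
    {f : Space d → ℂ} (hf : f ∈ ultraDiff M Ω) {K : Set (Space d)} (hK : K ⊆ Ω) :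
    ∀ x ∈ K, ContDiffAt ℝ ∞ f x :=
  fun _ hx => hf.1.contDiffAt (Ω.isOpen.mem_nhds (hK hx))

/-- The space `𝓓^{{M_p}}(K)`: smooth functions with support in `K` and `‖φ‖_{K,(r_i)} < ∞` for
all `(r_i) ∈ 𝓡`. -/
def testSpaceOn (M : WeightSequence) (K : Set (Space d)) : Submodule ℂ (Space d → ℂ) where
  carrier := {φ | ContDiff ℝ ∞ φ ∧ tsupport φ ⊆ K ∧ ∀ r ∈ seqR, ultraNorm M K r φ < ⊤}
  add_mem' {f g} hf hg := by
    refine ⟨hf.1.add hg.1, (tsupport_add f g).trans (Set.union_subset hf.2.1 hg.2.1),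
      fun r hr => ?_⟩
    exact (ultraNorm_add_le M hr (fun x _ => hf.1.contDiffAt)
      (fun x _ => hg.1.contDiffAt)).trans_lt
      (ENNReal.add_lt_top.2 ⟨hf.2.2 r hr, hg.2.2 r hr⟩)
  zero_mem' := ⟨contDiff_const, by simp [tsupport], fun r _ => by simp [ultraNorm_zero]⟩
  smul_mem' c f hf := by
    refine ⟨hf.1.const_smul c,
      (closure_mono (Function.support_const_smul_subset c f)).trans hf.2.1, fun r hr => ?_⟩
    exact (ultraNorm_smul_le M c (fun x _ => hf.1.contDiffAt)).trans_lt
      (ENNReal.mul_lt_top ENNReal.ofReal_lt_top (hf.2.2 r hr))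

theorem testSpaceOn_mono (M : WeightSequence) {K L : Set (Space d)} (h : K ⊆ L) :
    testSpaceOn M K ≤ testSpaceOn M L := fun _ hφ =>
  ⟨hφ.1, hφ.2.1.trans h, fun r hr =>
    (ultraNorm_le_of_tsupport_subset M r hφ.2.1).trans_lt (hφ.2.2 r hr)⟩

/-- The space `𝓓^{{M_p}}(Ω)` of test functions, the union of the `𝓓^{{M_p}}(K)` over the compact
sets `K ⊆ Ω`. -/
def testSpace (M : WeightSequence) (Ω : TopologicalSpace.Opens (Space d)) :
    Submodule ℂ (Space d → ℂ) where
  carrier := {φ | ∃ K : Set (Space d), IsCompact K ∧ K ⊆ Ω ∧ φ ∈ testSpaceOn M K}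
  add_mem' {f g} := by
    rintro ⟨K, hK, hKΩ, hf⟩ ⟨L, hL, hLΩ, hg⟩
    exact ⟨K ∪ L, hK.union hL, Set.union_subset hKΩ hLΩ,
      add_mem (testSpaceOn_mono M Set.subset_union_left hf)
        (testSpaceOn_mono M Set.subset_union_right hg)⟩
  zero_mem' := ⟨∅, isCompact_empty, Set.empty_subset _, zero_mem _⟩
  smul_mem' c f := by
    rintro ⟨K, hK, hKΩ, hf⟩
    exact ⟨K, hK, hKΩ, Submodule.smul_mem _ c hf⟩

/-- A Roumieu ultradistribution, an element of `𝓓'^{{M_p}}(Ω)`: a continuous linear functional on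
`𝓓^{{M_p}}(Ω)`. The topology of `𝓓^{{M_p}}(Ω)` is the locally convex inductive limit of those of the
spaces `𝓓^{{M_p}}(K)`, and these are given by the directed family of norms `‖·‖_{K,(r_i)}`,
`(r_i) ∈ 𝓡`; continuity is therefore a bound by one of these norms for each compact `K`. -/
structure Ultradistribution (M : WeightSequence) (Ω : TopologicalSpace.Opens (Space d)) where
  /-- The underlying linear functional. -/
  toLin : testSpace M Ω →ₗ[ℂ] ℂ
  continuous_on : ∀ K : Set (Space d), IsCompact K → K ⊆ Ω → ∃ r ∈ seqR, ∃ C : ℝ,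
    ∀ φ : testSpace M Ω, (φ : Space d → ℂ) ∈ testSpaceOn M K →
      ‖toLin φ‖ₑ ≤ ENNReal.ofReal C * ultraNorm M K r φ

/-- The index set `(0,1)` of nets. -/
abbrev Eps := Set.Ioo (0 : ℝ) 1

/-- `u_ε = O(v_ε)` as `ε → 0`. -/
def IsBigOEps (u : Eps → ℝ≥0∞) (v : Eps → ℝ) : Prop :=
  ∃ C : ℝ, 0 < C ∧ ∃ ε₀ : Eps, ∀ ε : Eps, ε < ε₀ → u ε ≤ ENNReal.ofReal (C * v ε)

section Aux

theorem IsBigOEps.add {u u' : Eps → ℝ≥0∞} {v : Eps → ℝ} (hv : ∀ ε, 0 ≤ v ε)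
    (h : IsBigOEps u v) (h' : IsBigOEps u' v) : IsBigOEps (fun ε => u ε + u' ε) v := by
  obtain ⟨C, hC, e, he⟩ := h
  obtain ⟨C', hC', e', he'⟩ := h'
  refine ⟨C + C', by positivity, min e e', fun ε hε => ?_⟩
  rw [add_mul, ENNReal.ofReal_add (mul_nonneg hC.le (hv ε)) (mul_nonneg hC'.le (hv ε))]
  exact add_le_add (he ε (hε.trans_le (min_le_left _ _))) (he' ε (hε.trans_le (min_le_right _ _)))

theorem IsBigOEps.mono {u u' : Eps → ℝ≥0∞} {v v' : Eps → ℝ} (h : IsBigOEps u v)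
    (hu : ∀ ε, u' ε ≤ u ε) (hv : ∀ ε, v ε ≤ v' ε) : IsBigOEps u' v' := by
  obtain ⟨C, hC, e, he⟩ := h
  exact ⟨C, hC, e, fun ε hε => ((hu ε).trans (he ε hε)).trans
    (ENNReal.ofReal_le_ofReal (mul_le_mul_of_nonneg_left (hv ε) hC.le))⟩

theorem IsBigOEps.const_mul {u : Eps → ℝ≥0∞} {v : Eps → ℝ}
    (h : IsBigOEps u v) {c : ℝ} (hc : 0 ≤ c) :
    IsBigOEps (fun ε => ENNReal.ofReal c * u ε) v := by
  obtain ⟨C, hC, e, he⟩ := h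
  refine ⟨(c + 1) * C, by positivity, e, fun ε hε => ?_⟩
  calc ENNReal.ofReal c * u ε ≤ ENNReal.ofReal (c + 1) * ENNReal.ofReal (C * v ε) :=
        mul_le_mul' (ENNReal.ofReal_le_ofReal (by linarith)) (he ε hε)
    _ = _ := by rw [← ENNReal.ofReal_mul (by positivity), mul_assoc]

theorem IsBigOEps.zero {v : Eps → ℝ} : IsBigOEps (fun _ => 0) v :=
  ⟨1, one_pos, ⟨1 / 2, by norm_num, by norm_num⟩, fun _ _ => zero_le⟩

theorem Eps.inv_pos (ε : Eps) : 0 < 1 / (ε : ℝ) := one_div_pos.2 ε.2.1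

end Aux

/-- The ultramoderate nets `𝓔_M^{{M_p}}(Ω)`: nets in `𝓔^{{M_p}}(Ω)` such that for all compact
`K ⊆ Ω` and all `(h_i) ∈ 𝓡` there is `(k_i) ∈ 𝓡` with
`‖g_ε‖_{K,(h_i)} = O(exp (N_{(k_i)}(1/ε)))`. -/
def moderate (M : WeightSequence) (Ω : TopologicalSpace.Opens (Space d)) :
    Submodule ℂ (Eps → Space d → ℂ) where
  carrier := {g | (∀ ε, g ε ∈ ultraDiff M Ω) ∧
    ∀ K : Set (Space d), IsCompact K → K ⊆ Ω → ∀ h ∈ seqR, ∃ k ∈ seqR,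
      IsBigOEps (fun ε => ultraNorm M K h (g ε)) (fun ε => Real.exp (assocFun M k (1 / ε)))}
  add_mem' {_ _} hf hg := by
    refine ⟨fun ε => add_mem (hf.1 ε) (hg.1 ε), fun K hK hKΩ h hh => ?_⟩
    obtain ⟨k, hk, hfk⟩ := hf.2 K hK hKΩ h hh
    obtain ⟨l, hl, hgl⟩ := hg.2 K hK hKΩ h hh
    have hkl := inf_mem_seqR hk hl
    have hfk' := hfk.mono (fun _ => le_rfl) (fun ε =>
      Real.exp_le_exp.2 (assocFun_anti M hkl hk inf_le_left (Eps.inv_pos ε)))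
    have hgl' := hgl.mono (fun _ => le_rfl) (fun ε =>
      Real.exp_le_exp.2 (assocFun_anti M hkl hl inf_le_right (Eps.inv_pos ε)))
    exact ⟨k ⊓ l, hkl, (IsBigOEps.add (fun _ => (Real.exp_pos _).le) hfk' hgl').mono
      (fun ε => ultraNorm_add_le M hh (ultraDiff_contDiffAt (hf.1 ε) hKΩ)
        (ultraDiff_contDiffAt (hg.1 ε) hKΩ)) (fun _ => le_rfl)⟩
  zero_mem' := ⟨fun _ => zero_mem _, fun K _ _ h _ =>
    ⟨_, id_mem_seqR, IsBigOEps.zero.mono (fun _ => (ultraNorm_zero M K h).le) (fun _ => le_rfl)⟩⟩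
  smul_mem' c _ hf := by
    refine ⟨fun ε => Submodule.smul_mem _ c (hf.1 ε), fun K hK hKΩ h hh => ?_⟩
    obtain ⟨k, hk, hfk⟩ := hf.2 K hK hKΩ h hh
    exact ⟨k, hk, (hfk.const_mul (norm_nonneg c)).mono
      (fun ε => ultraNorm_smul_le M c (ultraDiff_contDiffAt (hf.1 ε) hKΩ)) (fun _ => le_rfl)⟩

/-- The negligible nets `𝓝^{{M_p}}(Ω)`: nets in `𝓔^{{M_p}}(Ω)` such that
`‖g_ε‖_{K,(h_i)} = O(exp (-N_{(k_i)}(1/ε)))` for all compact `K ⊆ Ω` and all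
`(h_i), (k_i) ∈ 𝓡`. -/
def negligible (M : WeightSequence) (Ω : TopologicalSpace.Opens (Space d)) :
    Submodule ℂ (Eps → Space d → ℂ) where
  carrier := {g | (∀ ε, g ε ∈ ultraDiff M Ω) ∧
    ∀ K : Set (Space d), IsCompact K → K ⊆ Ω → ∀ h ∈ seqR, ∀ k ∈ seqR,
      IsBigOEps (fun ε => ultraNorm M K h (g ε)) (fun ε => Real.exp (-assocFun M k (1 / ε)))}
  add_mem' {_ _} hf hg :=
    ⟨fun ε => add_mem (hf.1 ε) (hg.1 ε), fun K hK hKΩ h hh k hk =>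
      (IsBigOEps.add (fun _ => (Real.exp_pos _).le) (hf.2 K hK hKΩ h hh k hk)
        (hg.2 K hK hKΩ h hh k hk)).mono
        (fun ε => ultraNorm_add_le M hh (ultraDiff_contDiffAt (hf.1 ε) hKΩ)
          (ultraDiff_contDiffAt (hg.1 ε) hKΩ)) (fun _ => le_rfl)⟩
  zero_mem' := ⟨fun _ => zero_mem _, fun K _ _ h _ _ _ =>
    IsBigOEps.zero.mono (fun _ => (ultraNorm_zero M K h).le) (fun _ => le_rfl)⟩
  smul_mem' c _ hf :=
    ⟨fun ε => Submodule.smul_mem _ c (hf.1 ε), fun K hK hKΩ h hh k hk =>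
      ((hf.2 K hK hKΩ h hh k hk).const_mul (norm_nonneg c)).mono
        (fun ε => ultraNorm_smul_le M c (ultraDiff_contDiffAt (hf.1 ε) hKΩ)) (fun _ => le_rfl)⟩

/-- The space `𝓖^{{M_p}}(Ω) = 𝓔_M^{{M_p}}(Ω) / 𝓝^{{M_p}}(Ω)` of generalized Roumieu
ultradistributions. -/
abbrev GenUltradistribution (M : WeightSequence) (Ω : TopologicalSpace.Opens (Space d)) :=
  moderate M Ω ⧸ (negligible M Ω).submoduleOf (moderate M Ω)

/-- The net `(g_ε)` represents `g`, i.e. `g = [(g_ε)]`. -/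
def Represents {M : WeightSequence} {Ω : TopologicalSpace.Opens (Space d)}
    (u : moderate M Ω) (g : GenUltradistribution M Ω) : Prop :=
  Submodule.Quotient.mk u = g

/-- The compact subsets of `Ω`. -/
abbrev CompactIn (Ω : TopologicalSpace.Opens (Space d)) :=
  {K : Set (Space d) // IsCompact K ∧ K ⊆ Ω}

/-- `g ∈ 𝓖^{∞,{M_p}}(Ω)` with regularity sequences `(k_i) = (k_i^K) ∈ 𝓡`: some representative
satisfies, for every compact `K ⊆ Ω` and every `(h_i) ∈ 𝓡`,
`‖g_ε‖_{K,(h_i)} = O(exp (N_{(k_i)}(1/ε)))`. The sequence may depend on `K` but not on `(h_i)`. -/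
def IsRegularWith {M : WeightSequence} {Ω : TopologicalSpace.Opens (Space d)}
    (g : GenUltradistribution M Ω) (k : CompactIn Ω → ℕ → ℝ) : Prop :=
  ∃ u : moderate M Ω, Represents u g ∧ ∀ K : CompactIn Ω, k K ∈ seqR ∧ ∀ h ∈ seqR,
    IsBigOEps (fun ε => ultraNorm M K.1 h (u.1 ε))
      (fun ε => Real.exp (assocFun M (k K) (1 / ε)))

/-- The pairing `⟨f, φ⟩ = ∫_Ω f φ dx`. -/
def pairing (Ω : TopologicalSpace.Opens (Space d)) (f φ : Space d → ℂ) : ℂ :=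
  ∫ x in (Ω : Set (Space d)), f x * φ x

/-- `g` is strongly `R`-associated to `T` with sequences `(b_i) = (b_i^K) ∈ 𝓡`: for every compact
`K ⊆ Ω` there is `(ℓ_i) ∈ 𝓡` such that
`|⟨g_ε - T, φ⟩| = O(exp (-N_{(b_i)}(1/ε)) ‖φ‖_{K,(ℓ_i)})` uniformly in `φ ∈ 𝓓^{{M_p}}(K)`. -/
def IsStronglyAssocWith {M : WeightSequence} {Ω : TopologicalSpace.Opens (Space d)}
    (g : GenUltradistribution M Ω) (T : Ultradistribution M Ω) (b : CompactIn Ω → ℕ → ℝ) : Prop :=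
  ∃ u : moderate M Ω, Represents u g ∧ ∀ K : CompactIn Ω, b K ∈ seqR ∧ ∃ l ∈ seqR,
    ∃ C : ℝ, 0 < C ∧ ∃ ε₀ : Eps, ∀ ε : Eps, ε < ε₀ →
      ∀ φ : testSpace M Ω, (φ : Space d → ℂ) ∈ testSpaceOn M K.1 →
        ‖pairing Ω (u.1 ε) φ - T.toLin φ‖ₑ ≤
          ENNReal.ofReal (C * Real.exp (-assocFun M (b K) (1 / ε))) * ultraNorm M K.1 l φ

/-- `T ∈ 𝓔^{{M_p}}(Ω)`: the ultradistribution `T` is given by integration against a Roumieu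
ultradifferentiable function. -/
def Ultradistribution.IsUltraDiff {M : WeightSequence} {Ω : TopologicalSpace.Opens (Space d)}
    (T : Ultradistribution M Ω) : Prop :=
  ∃ f ∈ ultraDiff M Ω, ∀ φ : testSpace M Ω, T.toLin φ = pairing Ω f φ

end Roumieu

end

/-!
The argument is a Fourier-analytic comparison of two estimates.

Let `L ⊆ Ω` be compact and let `χ` be a cut-off function of class `{M_p}` supported in `L`. Put
`F_ε(ξ) = 𝓕(χ g_ε)(ξ)` and `U(ξ) = ⟨T, χ exp(-2πi⟨·, ξ⟩)⟩`. Strong association, tested on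
`χ exp(-2πi⟨·, ξ⟩)`, gives `|F_ε(ξ) - U(ξ)| ≤ C exp(N_s(|ξ|) - N_b(1/ε))` for one sequence `s ∈ 𝓡`
(`exists_ultraNorm_mul_wave_le`), and regularity gives
`|F_ε(ξ)| ≤ C_h exp(N_k(1/ε) - N_h(|ξ|))` for every `h ∈ 𝓡` (`exists_norm_fourier_mul_le`). Since
`b ≤ k`, `N_k ≤ N_b`. Given `r ∈ 𝓡`, choose `ε` depending on `ξ` with
`N_b(1/ε) = N_s(|ξ|) + N_r(|ξ|)`, up to a constant, and `h` with `N_s + 2 N_r ≤ N_h + c`, which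
exists by (M.2). Both terms become `O(exp(-N_r(|ξ|)))`, so `U` decays like `exp(-N_r)` for every
`r ∈ 𝓡` (`exists_decay`), and its inverse Fourier transform `f` is ultradifferentiable
(`isUltra_fourierInv`). Letting `ε → 0` in `∫ χ g_ε φ = ∫ F_ε 𝓕⁻φ` identifies `T` with `f` on test
functions supported where `χ = 1` (`exists_local_representation`). The local representations are
glued by uniqueness (`isUltraDiff_of_local`).

The tools built for this are non-quasianalytic cut-off functions, obtained from infinitely iterated
averages over intervals of lengths proportional to `M_{j-1} / M_j`
(`exists_bump_line`, `exists_cutoff`); the symmetry of higher derivatives of real smooth functions,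
which turns bounds on partial derivatives into bounds on full derivatives
(`iteratedFDeriv_comp_equiv`, `norm_iteratedFDeriv_le_of_ultraNorm_le`); and the estimates between
`{M_p}`-bounds and decay of Fourier transforms (`norm_fourier_le`, `isUltra_fourier`).
-/

open scoped ENNReal ContDiff

noncomputable section

namespace Roumieu

open MeasureTheory FourierTransform

section

/-! ### Weight sequences and their associated functions -/

variable (M : WeightSequence) {r s : ℕ → ℝ}

theorem weighted_zero (r : ℕ → ℝ) : weighted M r 0 = 1 := by simp [weighted, M.zero]

theorem weighted_const_mul (c : ℝ) (r : ℕ → ℝ) (n : ℕ) :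
    weighted M (fun i => c * r i) n = c ^ n * weighted M r n := by
  simp only [weighted, Finset.prod_mul_distrib, Finset.prod_const, Finset.card_range]
  ring

theorem const_mul_mem_seqR {c : ℝ} (hc : 0 < c) (hr : r ∈ seqR) : (fun i => c * r i) ∈ seqR :=
  ⟨fun i => mul_pos hc (hr.1 i), fun _ _ h => mul_le_mul_of_nonneg_left (hr.2.1 h) hc.le,
    hr.2.2.const_mul_atTop hc⟩

theorem weight_ratio_mono : Monotone fun p => M (p + 1) / M p := by
  refine monotone_nat_of_le_succ fun p => ?_
  rw [div_le_div_iff₀ (M.pos _) (M.pos _)]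
  nlinarith [M.logConvex p]

theorem weight_mul_le (p q : ℕ) : M p * M q ≤ M (p + q) := by
  induction q with
  | zero => simp [M.zero]
  | succ q ih =>
    have h := weight_ratio_mono M (Nat.le_add_left q p)
    have e1 : M (q + 1) = M q * (M (q + 1) / M q) := by
      rw [mul_div_cancel₀ _ (M.pos q).ne']
    have e2 : M (p + q + 1) = M (p + q) * (M (p + q + 1) / M (p + q)) := by
      rw [mul_div_cancel₀ _ (M.pos (p + q)).ne']
    rw [← add_assoc, e1, e2, ← mul_assoc]
    exact mul_le_mul ih h (div_pos (M.pos _) (M.pos _)).le (M.pos _).le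

theorem prod_mul_prod_le (hr : r ∈ seqR) (p q : ℕ) :
    (∏ i ∈ Finset.range p, r i) * ∏ i ∈ Finset.range q, r i ≤ ∏ i ∈ Finset.range (p + q), r i := by
  rw [Finset.prod_range_add]
  refine mul_le_mul_of_nonneg_left ?_ (Finset.prod_nonneg fun i _ => (hr.1 i).le)
  exact Finset.prod_le_prod (fun i _ => (hr.1 i).le) fun i _ => hr.2.1 (Nat.le_add_left i p)

theorem weighted_mul_le (hr : r ∈ seqR) (p q : ℕ) :
    weighted M r p * weighted M r q ≤ weighted M r (p + q) := by
  have h := mul_le_mul (weight_mul_le M p q) (prod_mul_prod_le hr p q)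
    (mul_nonneg (Finset.prod_nonneg fun i _ => (hr.1 i).le)
      (Finset.prod_nonneg fun i _ => (hr.1 i).le)) (M.pos _).le
  unfold weighted
  linarith

/-- Products of a sequence in `𝓡` dominate every geometric sequence. -/
theorem pow_le_prod (hr : r ∈ seqR) {h : ℝ} (hh : 0 < h) :
    ∃ C : ℝ, 0 < C ∧ ∀ n, h ^ n ≤ C * ∏ i ∈ Finset.range n, r i := by
  obtain ⟨P, hP⟩ := Filter.eventually_atTop.1 (hr.2.2.eventually_ge_atTop h)
  have hpos : ∀ n, 0 < ∏ i ∈ Finset.range n, r i := fun n => Finset.prod_pos fun i _ => hr.1 i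
  refine ⟨∑ n ∈ Finset.range (P + 1), h ^ n / ∏ i ∈ Finset.range n, r i,
    Finset.sum_pos (fun n _ => div_pos (pow_pos hh n) (hpos n)) ⟨0, by simp⟩, ?_⟩
  have hsmall : ∀ n ≤ P, h ^ n ≤ (∑ n ∈ Finset.range (P + 1),
      h ^ n / ∏ i ∈ Finset.range n, r i) * ∏ i ∈ Finset.range n, r i := by
    intro n hn
    rw [← div_le_iff₀ (hpos n)]
    exact Finset.single_le_sum (f := fun n => h ^ n / ∏ i ∈ Finset.range n, r i)
      (fun m _ => (div_pos (pow_pos hh m) (hpos m)).le) (Finset.mem_range.2 (by omega))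
  intro n
  rcases le_total n P with hn | hn
  · exact hsmall n hn
  · induction n, hn using Nat.le_induction with
    | base => exact hsmall P le_rfl
    | succ n hn ih =>
      rw [pow_succ, Finset.prod_range_succ, ← mul_assoc]
      exact mul_le_mul ih (hP n hn) hh.le ((pow_pos hh n).le.trans ih)

theorem assocFun_nonneg (r : ℕ → ℝ) (ρ : ℝ) : 0 ≤ assocFun M r ρ :=
  Real.iSup_nonneg fun _ => Real.posLog_nonneg

theorem pow_le_weighted_mul_exp (hr : r ∈ seqR) {ρ : ℝ} (hρ : 0 ≤ ρ) (p : ℕ) :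
    ρ ^ p ≤ weighted M r p * Real.exp (assocFun M r ρ) := by
  have hw := weighted_pos M hr p
  rcases hρ.eq_or_lt with rfl | hρ
  · rcases p with _ | p
    · simpa [weighted_zero] using assocFun_nonneg M r 0
    · rw [zero_pow (Nat.succ_ne_zero p)]; positivity
  · have h1 : Real.log (ρ ^ p / weighted M r p) ≤ assocFun M r ρ :=
      (le_max_right 0 _).trans (le_ciSup (bddAbove_assoc M hr hρ) p)
    rw [Real.log_le_iff_le_exp (div_pos (pow_pos hρ p) hw), div_le_iff₀ hw] at h1
    linarith

/-- Together with `pow_le_weighted_mul_exp`: `exp N_{(r_i)}(ρ)` is the least upper bound of the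
`ρ ^ p / (M_p ∏_{i ≤ p} r_i)`; the truncation in `ln₊` is absorbed by the term `p = 0`. -/
theorem exp_assocFun_le (hr : r ∈ seqR) {ρ B : ℝ} (hρ : 0 ≤ ρ)
    (h : ∀ p, ρ ^ p ≤ B * weighted M r p) : Real.exp (assocFun M r ρ) ≤ B := by
  have hB : 1 ≤ B := by simpa [weighted_zero] using h 0
  rw [← Real.le_log_iff_exp_le (by linarith)]
  refine ciSup_le fun p => max_le (Real.log_nonneg hB) ?_
  have hw := weighted_pos M hr p
  have hle : ρ ^ p / weighted M r p ≤ B := by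
    rw [div_le_iff₀ hw]; exact h p
  rcases (div_nonneg (pow_nonneg hρ p) hw.le).eq_or_lt with h0 | h0
  · rw [← h0, Real.log_zero]; exact Real.log_nonneg hB
  · exact Real.log_le_log h0 hle

theorem le_mul_exp_neg_assocFun (hr : r ∈ seqR) {ρ A z : ℝ} (hρ : 0 ≤ ρ) (hA : 0 ≤ A)
    (h : ∀ p, ρ ^ p * z ≤ A * weighted M r p) : z ≤ A * Real.exp (-assocFun M r ρ) := by
  rcases le_or_gt z 0 with hz | hz
  · exact hz.trans (by positivity)
  · have := exp_assocFun_le M hr (B := A / z) hρ fun p => by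
      rw [div_mul_eq_mul_div, le_div_iff₀ hz]; exact h p
    rw [Real.exp_neg, ← div_eq_mul_inv, le_div_iff₀ (Real.exp_pos _)]
    rw [le_div_iff₀ hz] at this
    linarith

theorem assocFun_le_of_le (hr : r ∈ seqR) (hs : s ∈ seqR) (hrs : ∀ i, r i ≤ s i) {ρ : ℝ}
    (hρ : 0 ≤ ρ) : assocFun M s ρ ≤ assocFun M r ρ := by
  rw [← Real.exp_le_exp]
  refine exp_assocFun_le M hs hρ fun p => ?_
  rw [mul_comm]
  refine (pow_le_weighted_mul_exp M hr hρ p).trans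
    (mul_le_mul_of_nonneg_right ?_ (Real.exp_pos _).le)
  exact mul_le_mul_of_nonneg_left
    (Finset.prod_le_prod (fun i _ => (hr.1 i).le) fun i _ => hrs i) (M.pos p).le

theorem prod_range_half (r : ℕ → ℝ) (p : ℕ) :
    ∏ i ∈ Finset.range (2 * p), r (i / 2) = (∏ i ∈ Finset.range p, r i) ^ 2 := by
  induction p with
  | zero => simp
  | succ p ih =>
    rw [show 2 * (p + 1) = 2 * p + 1 + 1 by ring, Finset.prod_range_succ, Finset.prod_range_succ,
      ih, Finset.prod_range_succ, show (2 * p + 1) / 2 = p by omega,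
      show 2 * p / 2 = p by omega]
    ring

/-- Doubling the associated function amounts, by (M.2), to passing to a smaller sequence: each
term is repeated twice and divided by the constant of (M.2). -/
theorem exists_two_mul_assocFun_le (hr : r ∈ seqR) :
    ∃ h ∈ seqR, ∃ c : ℝ, 0 ≤ c ∧ ∀ ρ, 0 ≤ ρ → 2 * assocFun M r ρ ≤ assocFun M h ρ + c := by
  obtain ⟨c₀, H, hc₀, hH, hM⟩ := M.stable
  have hH0 : 0 < H := by linarith
  have hhalf : (fun i => r (i / 2)) ∈ seqR := by
    refine ⟨fun i => hr.1 _, fun i j hij => hr.2.1 (Nat.div_le_div_right hij), ?_⟩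
    exact hr.2.2.comp (Nat.tendsto_div_const_atTop two_ne_zero)
  refine ⟨fun i => H⁻¹ * r (i / 2), const_mul_mem_seqR (inv_pos.2 hH0) hhalf, Real.log c₀,
    Real.log_nonneg hc₀, fun ρ hρ => ?_⟩
  set h : ℕ → ℝ := fun i => H⁻¹ * r (i / 2)
  have hh : h ∈ seqR := const_mul_mem_seqR (inv_pos.2 hH0) hhalf
  have key : Real.exp (assocFun M r ρ) ≤ √(c₀ * Real.exp (assocFun M h ρ)) := by
    refine exp_assocFun_le M hr hρ fun p => ?_
    have hw := weighted_pos M hr p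
    have e : weighted M h (2 * p) ≤ c₀ * weighted M r p ^ 2 := by
      have h1 := hM (2 * p) p (by omega)
      rw [show 2 * p - p = p by omega] at h1
      rw [weighted_const_mul]
      unfold weighted
      rw [prod_range_half, inv_pow, inv_mul_le_iff₀ (by positivity)]
      have := mul_le_mul_of_nonneg_right h1 (sq_nonneg (∏ i ∈ Finset.range p, r i))
      linarith
    have h2 := pow_le_weighted_mul_exp M hh hρ (2 * p)
    rw [← pow_le_pow_iff_left₀ (by positivity) (by positivity) two_ne_zero, mul_pow,
      Real.sq_sqrt (by positivity), ← pow_mul, mul_comm p 2]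
    calc _ ≤ _ := h2
      _ ≤ c₀ * weighted M r p ^ 2 * Real.exp (assocFun M h ρ) := by gcongr
      _ = _ := by ring
  have h3 : Real.exp (2 * assocFun M r ρ) ≤ Real.exp (assocFun M h ρ + Real.log c₀) := by
    rw [two_mul, Real.exp_add, Real.exp_add, Real.exp_log (by linarith), ← sq]
    calc _ ≤ √(c₀ * Real.exp (assocFun M h ρ)) ^ 2 := by gcongr
      _ = _ := by rw [Real.sq_sqrt (by positivity), mul_comm]
  exact Real.exp_le_exp.1 h3

theorem exists_assocFun_add_le (hr : r ∈ seqR) (hs : s ∈ seqR) :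
    ∃ h ∈ seqR, ∃ c : ℝ, 0 ≤ c ∧ ∀ ρ, 0 ≤ ρ →
      assocFun M s ρ + 2 * assocFun M r ρ ≤ assocFun M h ρ + c := by
  have hm := inf_mem_seqR hr hs
  -- both functions are at most `N_{min(r, s)}`, whose fourfold is reached by doubling twice
  obtain ⟨h₁, hh₁, c₁, hc₁, H₁⟩ := exists_two_mul_assocFun_le M hm
  obtain ⟨h₂, hh₂, c₂, hc₂, H₂⟩ := exists_two_mul_assocFun_le M hh₁
  refine ⟨h₂, hh₂, c₂ + 2 * c₁, by positivity, fun ρ hρ => ?_⟩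
  have a := assocFun_le_of_le M hm hr (fun i => min_le_left _ _) hρ
  have b := assocFun_le_of_le M hm hs (fun i => min_le_right _ _) hρ
  have := assocFun_nonneg M (r ⊓ s) ρ
  linarith [H₁ ρ hρ, H₂ ρ hρ]

/-- The function `t ↦ N_{(r_i)}(e^t)` is a supremum of affine functions and of `0`, hence convex and
therefore continuous. -/
theorem continuous_assocFun_exp (hr : r ∈ seqR) :
    Continuous fun t : ℝ => assocFun M r (Real.exp t) := by
  have hpl : ∀ (t : ℝ) (p : ℕ), Real.posLog (Real.exp t ^ p / weighted M r p) =
      max 0 (p * t - Real.log (weighted M r p)) := fun t p => by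
    rw [Real.posLog, Real.log_div (by positivity) (weighted_pos M hr p).ne', ← Real.exp_nat_mul,
      Real.log_exp]
  have hconv : ConvexOn ℝ Set.univ fun t : ℝ => assocFun M r (Real.exp t) := by
    refine ⟨convex_univ, fun x _ y _ a b ha hb hab => ?_⟩
    refine ciSup_le fun p => ?_
    have hle : ∀ t : ℝ, max 0 (p * t - Real.log (weighted M r p)) ≤ assocFun M r (Real.exp t) :=
      fun t => (hpl t p).symm.le.trans (le_ciSup (bddAbove_assoc M hr (Real.exp_pos t)) p)
    have hx := hle x
    have hy := hle y
    rw [hpl]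
    have hx1 := (le_max_left _ _).trans hx
    have hx2 := (le_max_right _ _).trans hx
    have hy1 := (le_max_left _ _).trans hy
    have hy2 := (le_max_right _ _).trans hy
    simp only [smul_eq_mul]
    refine max_le (add_nonneg (mul_nonneg ha hx1) (mul_nonneg hb hy1)) ?_
    calc (p : ℝ) * (a * x + b * y) - Real.log (weighted M r p)
        = a * (p * x - Real.log (weighted M r p)) + b * (p * y - Real.log (weighted M r p)) := by
          linear_combination Real.log (weighted M r p) * hab
      _ ≤ _ := add_le_add (mul_le_mul_of_nonneg_left hx2 ha) (mul_le_mul_of_nonneg_left hy2 hb)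
  exact continuousOn_univ.1 (hconv.continuousOn isOpen_univ)

/-- The associated function attains every sufficiently large value. -/
theorem exists_assocFun_eq (hr : r ∈ seqR) {ρ A : ℝ} (hρ : 0 < ρ) (hA : assocFun M r ρ ≤ A) :
    ∃ σ, ρ ≤ σ ∧ assocFun M r σ = A := by
  -- the term `p = 1` alone exceeds `exp A` at `τ`
  set τ := max ρ (weighted M r 1 * Real.exp A)
  have hρτ : ρ ≤ τ := le_max_left _ _
  have hτ : A ≤ assocFun M r τ := by
    have h1 := pow_le_weighted_mul_exp M hr (hρ.le.trans hρτ) 1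
    rw [pow_one] at h1
    have h2 := (le_max_right ρ (weighted M r 1 * Real.exp A)).trans h1
    exact Real.exp_le_exp.1 (le_of_mul_le_mul_left h2 (weighted_pos M hr 1))
  have hl : Real.log ρ ≤ Real.log τ := Real.log_le_log hρ hρτ
  obtain ⟨t, ht, htA⟩ := intermediate_value_Icc hl (continuous_assocFun_exp M hr).continuousOn
    (show A ∈ Set.Icc _ _ by
      rw [Real.exp_log hρ, Real.exp_log (hρ.trans_le hρτ)]; exact ⟨hA, hτ⟩)
  exact ⟨Real.exp t, (Real.log_le_iff_le_exp hρ).1 ht.1, htA⟩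

/-- `exp (-N_{(r_i)})` decays faster than every power. -/
theorem exists_exp_neg_assocFun_le (hr : r ∈ seqR) (m : ℕ) :
    ∃ C : ℝ, 0 < C ∧ ∀ ρ, 0 ≤ ρ →
      Real.exp (-assocFun M r ρ) ≤ C * (1 + ρ) ^ (-(m : ℝ)) := by
  have hw := weighted_pos M hr m
  refine ⟨2 ^ m * (1 + weighted M r m), by positivity, fun ρ hρ => ?_⟩
  rw [Real.rpow_neg (by positivity), Real.rpow_natCast, Real.exp_neg, ← div_eq_mul_inv,
    le_div_iff₀ (by positivity), inv_mul_le_iff₀ (Real.exp_pos _)]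
  have h1 : (1 + ρ) ^ m ≤ 2 ^ m * (1 + ρ ^ m) := by
    calc (1 + ρ) ^ m ≤ (2 * max 1 ρ) ^ m := by
          gcongr; linarith [le_max_left 1 ρ, le_max_right 1 ρ]
      _ = 2 ^ m * max 1 ρ ^ m := by rw [mul_pow]
      _ ≤ _ := by
          gcongr
          rcases max_choice 1 ρ with h | h <;> rw [h]
          · simpa using pow_nonneg hρ m
          · linarith
  have h2 := pow_le_weighted_mul_exp M hr hρ m
  have h3 := Real.one_le_exp (assocFun_nonneg M r ρ)
  calc (1 + ρ) ^ m ≤ 2 ^ m * (1 + ρ ^ m) := h1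
    _ ≤ 2 ^ m * (Real.exp (assocFun M r ρ) + weighted M r m * Real.exp (assocFun M r ρ)) := by
        gcongr
    _ = _ := by ring

end

section

/-! ### Functions with uniform ultradifferentiable bounds -/

section Algebra

variable {E : Type*} [NormedAddCommGroup E] [NormedSpace ℝ E]
  {G : Type*} [NormedAddCommGroup G] [NormedSpace ℝ G]
  {A : Type*} [NormedRing A] [NormedAlgebra ℝ A]
  {B : Type*} [NormedCommRing B] [NormedAlgebra ℝ B]

/-- The Leibniz rule in weighted form: passing to a product doubles the weight sequence. -/
theorem norm_iteratedFDeriv_mul_le_weighted (M : WeightSequence) {r : ℕ → ℝ} (hr : r ∈ seqR)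
    {f g : E → A} {s : Set E} (hs : IsOpen s) {x : E} (hx : x ∈ s) {a b : ℝ}
    (hf : ContDiffOn ℝ ∞ f s) (hg : ContDiffOn ℝ ∞ g s)
    (ha : ∀ n, ‖iteratedFDeriv ℝ n f x‖ ≤ a * weighted M r n)
    (hb : ∀ n, ‖iteratedFDeriv ℝ n g x‖ ≤ b * weighted M r n) (n : ℕ) :
    ‖iteratedFDeriv ℝ n (fun y => f y * g y) x‖ ≤
      a * b * weighted M (fun i => 2 * r i) n := by
  have ha0 : 0 ≤ a := by simpa [weighted_zero] using (norm_nonneg _).trans (ha 0)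
  have hb0 : 0 ≤ b := by simpa [weighted_zero] using (norm_nonneg _).trans (hb 0)
  have hleib := norm_iteratedFDerivWithin_mul_le (𝕜 := ℝ) hf hg hs.uniqueDiffOn hx (n := n)
    (by exact_mod_cast le_top)
  simp only [iteratedFDerivWithin_of_isOpen _ hs hx] at hleib
  refine hleib.trans ?_
  have hstep : ∀ i ∈ Finset.range (n + 1),
      (n.choose i : ℝ) * ‖iteratedFDeriv ℝ i f x‖ * ‖iteratedFDeriv ℝ (n - i) g x‖ ≤
        (n.choose i : ℝ) * (a * b * weighted M r n) := by
    intro i hi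
    have hin : i + (n - i) = n := by have := Finset.mem_range.1 hi; omega
    have hw := weighted_mul_le M hr i (n - i)
    rw [hin] at hw
    rw [mul_assoc]
    refine mul_le_mul_of_nonneg_left ?_ (Nat.cast_nonneg _)
    calc _ ≤ (a * weighted M r i) * (b * weighted M r (n - i)) :=
          mul_le_mul (ha i) (hb _) (norm_nonneg _) ((norm_nonneg _).trans (ha i))
      _ = a * b * (weighted M r i * weighted M r (n - i)) := by ring
      _ ≤ a * b * weighted M r n := mul_le_mul_of_nonneg_left hw (mul_nonneg ha0 hb0)
  refine (Finset.sum_le_sum hstep).trans_eq ?_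
  rw [← Finset.sum_mul, weighted_const_mul]
  have : (∑ i ∈ Finset.range (n + 1), (n.choose i : ℝ)) = 2 ^ n := by
    exact_mod_cast Nat.sum_range_choose n
  rw [this]; ring

/-- Smooth functions on the whole space with the bounds of the Roumieu class `{M_p}` uniformly on
the whole space, expressed by the norms of the full derivatives: for each `(r_i) ∈ 𝓡` the
derivatives of order `n` are `O(M_n ∏_{i ≤ n} r_i)`. -/
def IsUltra (M : WeightSequence) (f : E → G) : Prop :=
  ContDiff ℝ ∞ f ∧ ∀ r ∈ seqR, ∃ C : ℝ, ∀ n x, ‖iteratedFDeriv ℝ n f x‖ ≤ C * weighted M r n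

variable {M : WeightSequence}

theorem IsUltra.const (c : G) : IsUltra M fun _ : E => c := by
  refine ⟨contDiff_const, fun r hr => ⟨‖c‖, fun n x => ?_⟩⟩
  rcases n with _ | n
  · simp [weighted_zero]
  · rw [iteratedFDeriv_succ_const]
    simpa using mul_nonneg (norm_nonneg c) (weighted_pos M hr _).le

theorem IsUltra.mul {f g : E → A} (hf : IsUltra M f) (hg : IsUltra M g) :
    IsUltra M fun x => f x * g x := by
  refine ⟨hf.1.mul hg.1, fun r hr => ?_⟩
  have hr' := const_mul_mem_seqR (c := 2⁻¹) (by norm_num) hr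
  obtain ⟨a, ha⟩ := hf.2 _ hr'
  obtain ⟨b, hb⟩ := hg.2 _ hr'
  refine ⟨a * b, fun n x => ?_⟩
  have := norm_iteratedFDeriv_mul_le_weighted M hr' isOpen_univ (Set.mem_univ x)
    hf.1.contDiffOn hg.1.contDiffOn (fun n => ha n x) (fun n => hb n x) n
  simpa using this

theorem IsUltra.sub {f g : E → G} (hf : IsUltra M f) (hg : IsUltra M g) :
    IsUltra M fun x => f x - g x := by
  refine ⟨hf.1.sub hg.1, fun r hr => ?_⟩
  obtain ⟨a, ha⟩ := hf.2 r hr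
  obtain ⟨b, hb⟩ := hg.2 r hr
  refine ⟨a + b, fun n x => ?_⟩
  have h : iteratedFDeriv ℝ n (fun x => f x - g x) x =
      iteratedFDeriv ℝ n f x - iteratedFDeriv ℝ n g x :=
    iteratedFDeriv_sub_apply (hf.1.contDiffAt.of_le (by exact_mod_cast le_top))
      (hg.1.contDiffAt.of_le (by exact_mod_cast le_top))
  rw [h, add_mul]
  exact (norm_sub_le _ _).trans (add_le_add (ha n x) (hb n x))

theorem IsUltra.prod {ι : Type*} (t : Finset ι) {f : ι → E → B} (hf : ∀ i ∈ t, IsUltra M (f i)) :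
    IsUltra M fun x => ∏ i ∈ t, f i x := by
  classical
  induction t using Finset.induction_on with
  | empty => simpa using IsUltra.const 1
  | insert i t hi ih =>
    simp only [Finset.prod_insert hi]
    exact (hf i (Finset.mem_insert_self i t)).mul
      (ih fun j hj => hf j (Finset.mem_insert_of_mem hj))

theorem IsUltra.comp_clm {H : Type*} [NormedAddCommGroup H] [NormedSpace ℝ H] {f : E → G}
    (hf : IsUltra M f) (L : H →L[ℝ] E) : IsUltra M fun x => f (L x) := by
  refine ⟨hf.1.comp L.contDiff, fun r hr => ?_⟩
  have hL : 0 < ‖L‖ + 1 := by positivity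
  have hr' := const_mul_mem_seqR (inv_pos.2 hL) hr
  obtain ⟨a, ha⟩ := hf.2 _ hr'
  refine ⟨a, fun n x => ?_⟩
  have ha0 : 0 ≤ a := by simpa [weighted_zero] using (norm_nonneg _).trans (ha 0 0)
  have h := L.iteratedFDeriv_comp_right hf.1 x (i := n) (by exact_mod_cast le_top)
  change ‖iteratedFDeriv ℝ n (f ∘ L) x‖ ≤ _
  rw [h]
  refine (ContinuousMultilinearMap.norm_compContinuousLinearMap_le _ _).trans ?_
  rw [Finset.prod_const, Finset.card_univ, Fintype.card_fin]
  have hw := weighted_pos M hr n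
  have h1 := ha n (L x)
  rw [weighted_const_mul] at h1
  calc _ ≤ (a * ((‖L‖ + 1)⁻¹ ^ n * weighted M r n)) * (‖L‖ + 1) ^ n := by
        gcongr; linarith
    _ = a * weighted M r n := by
        rw [inv_pow]; field_simp

theorem IsUltra.clm_comp {H : Type*} [NormedAddCommGroup H] [NormedSpace ℝ H] {f : E → G}
    (hf : IsUltra M f) (L : G →L[ℝ] H) : IsUltra M fun x => L (f x) := by
  refine ⟨L.contDiff.comp hf.1, fun r hr => ?_⟩
  obtain ⟨a, ha⟩ := hf.2 r hr
  refine ⟨‖L‖ * a, fun n x => ?_⟩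
  rw [mul_assoc]
  exact (L.norm_iteratedFDeriv_comp_left hf.1.contDiffAt (n := n) (by exact_mod_cast le_top)).trans
    (mul_le_mul_of_nonneg_left (ha n x) (norm_nonneg _))

end Algebra

end

section

/-! ### Ultradifferentiable bump functions on the line -/

section Bump

variable (a : ℕ → ℝ) (f : ℝ → ℝ)

/-- Iterated averages: `f` is averaged over `[x, x + a_{k+n-1}]`, …, `[x, x + a_k]` in turn. -/
def iterAvg : ℕ → ℕ → ℝ → ℝ
  | 0, _ => f
  | n + 1, k => fun x => ∫ t in (0 : ℝ)..1, iterAvg n (k + 1) (x + a k * t)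

variable {a f}

theorem iterAvg_lipschitz {K : NNReal} (hf : LipschitzWith K f) (n k : ℕ) :
    LipschitzWith K (iterAvg a f n k) := by
  induction n generalizing k with
  | zero => exact hf
  | succ n ih =>
    have hc := (ih (k + 1)).continuous
    refine LipschitzWith.of_dist_le_mul fun x y => ?_
    simp only [iterAvg]
    rw [Real.dist_eq, ← intervalIntegral.integral_sub
      (Continuous.intervalIntegrable (by fun_prop) _ _)
      (Continuous.intervalIntegrable (by fun_prop) _ _)]
    have := intervalIntegral.norm_integral_le_of_norm_le_const (a := (0 : ℝ)) (b := 1)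
      (C := K * dist x y)
      (f := fun t => iterAvg a f n (k + 1) (x + a k * t) - iterAvg a f n (k + 1) (y + a k * t))
      fun t _ => by
        have := (ih (k + 1)).dist_le_mul (x + a k * t) (y + a k * t)
        rwa [dist_add_right, Real.dist_eq] at this
    simpa using this

theorem iterAvg_dist_le {K : NNReal} (ha : ∀ k, 0 < a k) (hf : LipschitzWith K f) (n k : ℕ)
    (x : ℝ) : dist (iterAvg a f n k x) (iterAvg a f (n + 1) k x) ≤ K * a (k + n) := by
  induction n generalizing k x with
  | zero =>
    have hc := hf.continuous
    simp only [iterAvg]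
    have h1 : f x = ∫ t in (0 : ℝ)..1, f x := by simp
    rw [h1, Real.dist_eq, ← intervalIntegral.integral_sub
      (Continuous.intervalIntegrable (by fun_prop) _ _)
      (Continuous.intervalIntegrable (by fun_prop) _ _)]
    have := intervalIntegral.norm_integral_le_of_norm_le_const (a := (0 : ℝ)) (b := 1)
      (C := K * a (k + 0)) (f := fun t => f x - f (x + a k * t)) fun t ht => by
        rw [Set.uIoc_of_le zero_le_one] at ht
        have := hf.dist_le_mul x (x + a k * t)
        rw [dist_self_add_right, Real.norm_eq_abs, abs_of_nonneg
          (mul_nonneg (ha k).le ht.1.le)] at this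
        refine this.trans (mul_le_mul_of_nonneg_left ?_ K.2)
        exact mul_le_of_le_one_right (ha k).le ht.2
    simpa using this
  | succ n ih =>
    have hc1 := (iterAvg_lipschitz (a := a) hf n (k + 1)).continuous
    have hc2 := (iterAvg_lipschitz (a := a) hf (n + 1) (k + 1)).continuous
    rw [iterAvg, iterAvg, Real.dist_eq, ← intervalIntegral.integral_sub
      (Continuous.intervalIntegrable (by fun_prop) _ _)
      (Continuous.intervalIntegrable (by fun_prop) _ _)]
    have := intervalIntegral.norm_integral_le_of_norm_le_const (a := (0 : ℝ)) (b := 1)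
      (C := K * a (k + (n + 1))) (f := fun t => iterAvg a f n (k + 1) (x + a k * t) -
        iterAvg a f (n + 1) (k + 1) (x + a k * t)) fun t ht => by
        have := ih (k + 1) (x + a k * t)
        rwa [Real.dist_eq, add_right_comm, add_assoc] at this
    simpa using this

/-- Averaging preserves pointwise bounds; only the values of `f` within the total length of the
intervals matter. -/
theorem iterAvg_mem_Icc {K : NNReal} (ha : ∀ k, 0 < a k) (hf : LipschitzWith K f) {p q : ℝ}
    (n k : ℕ) (x : ℝ)
    (h : ∀ y ∈ Set.Icc x (x + ∑ i ∈ Finset.range n, a (k + i)), f y ∈ Set.Icc p q) :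
    iterAvg a f n k x ∈ Set.Icc p q := by
  induction n generalizing k x with
  | zero => exact h x (by simp)
  | succ n ih =>
    have hc := (iterAvg_lipschitz (a := a) hf n (k + 1)).continuous
    have hmem : ∀ t ∈ Set.Icc (0 : ℝ) 1, iterAvg a f n (k + 1) (x + a k * t) ∈ Set.Icc p q := by
      intro t ht
      refine ih _ _ fun y hy => h y ⟨?_, ?_⟩
      · linarith [hy.1, mul_nonneg (ha k).le ht.1]
      · have h1 := mul_le_of_le_one_right (ha k).le ht.2
        have h2 : ∑ i ∈ Finset.range n, a (k + 1 + i) = ∑ i ∈ Finset.range n, a (k + (i + 1)) :=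
          Finset.sum_congr rfl fun i _ => by rw [add_right_comm, add_assoc]
        rw [Finset.sum_range_succ', ← h2, add_zero]
        linarith [hy.2]
    have hint : IntervalIntegrable (fun t => iterAvg a f n (k + 1) (x + a k * t))
        MeasureTheory.volume 0 1 := Continuous.intervalIntegrable (by fun_prop) _ _
    constructor
    · have := intervalIntegral.integral_mono_on zero_le_one
        (intervalIntegrable_const (c := p)) hint fun t ht => (hmem t ht).1
      simpa [iterAvg] using this
    · have := intervalIntegral.integral_mono_on zero_le_one hint
        (intervalIntegrable_const (c := q)) fun t ht => (hmem t ht).2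
      simpa [iterAvg] using this

/-- The infinite iterated average of `f`, over intervals of lengths `a_k, a_{k+1}, …`. -/
def limAvg (a : ℕ → ℝ) (f : ℝ → ℝ) (k : ℕ) (x : ℝ) : ℝ :=
  Filter.atTop.limUnder fun n => iterAvg a f n k x

theorem tendsto_limAvg {K : NNReal} (ha : ∀ k, 0 < a k) (hs : Summable a)
    (hf : LipschitzWith K f) (k : ℕ) (x : ℝ) :
    Filter.Tendsto (fun n => iterAvg a f n k x) Filter.atTop (nhds (limAvg a f k x)) := by
  have hs' : Summable fun n => K * a (k + n) :=
    ((summable_nat_add_iff k).2 hs |>.congr fun n => by rw [add_comm]).mul_left _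
  exact (cauchySeq_of_dist_le_of_summable _
    (fun n => iterAvg_dist_le ha hf n k x) hs').tendsto_limUnder

theorem limAvg_lipschitz {K : NNReal} (ha : ∀ k, 0 < a k) (hs : Summable a)
    (hf : LipschitzWith K f) (k : ℕ) : LipschitzWith K (limAvg a f k) :=
  LipschitzWith.of_dist_le_mul fun x y => le_of_tendsto
    ((tendsto_limAvg ha hs hf k x).dist (tendsto_limAvg ha hs hf k y))
    (Filter.Eventually.of_forall fun n => (iterAvg_lipschitz (a := a) hf n k).dist_le_mul x y)

theorem limAvg_mem_Icc {K : NNReal} (ha : ∀ k, 0 < a k) (hs : Summable a)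
    (hf : LipschitzWith K f) {p q : ℝ} (x : ℝ)
    (h : ∀ y ∈ Set.Icc x (x + ∑' i, a i), f y ∈ Set.Icc p q) (k : ℕ) :
    limAvg a f k x ∈ Set.Icc p q := by
  refine isClosed_Icc.mem_of_tendsto (tendsto_limAvg ha hs hf k x)
    (Filter.Eventually.of_forall fun n => iterAvg_mem_Icc ha hf n k x fun y hy => h y ⟨hy.1, ?_⟩)
  refine hy.2.trans (add_le_add_right ?_ x)
  have h1 : ∑ i ∈ Finset.range n, a (k + i) ≤ ∑ i ∈ Finset.range (k + n), a i := by
    rw [Finset.sum_range_add]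
    exact le_add_of_nonneg_left (Finset.sum_nonneg fun i _ => (ha i).le)
  exact h1.trans (hs.sum_le_tsum _ fun i _ => (ha i).le)

theorem limAvg_eq_integral {K : NNReal} (ha : ∀ k, 0 < a k) (hs : Summable a)
    (hf : LipschitzWith K f) {C : ℝ} (hC : ∀ y, |f y| ≤ C) (k : ℕ) (x : ℝ) :
    limAvg a f k x = ∫ t in (0 : ℝ)..1, limAvg a f (k + 1) (x + a k * t) := by
  refine tendsto_nhds_unique
    ((tendsto_limAvg ha hs hf k x).comp (Filter.tendsto_add_atTop_nat 1)) ?_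
  change Filter.Tendsto (fun n => ∫ t in (0 : ℝ)..1, iterAvg a f n (k + 1) (x + a k * t)) _ _
  refine intervalIntegral.tendsto_integral_filter_of_dominated_convergence (fun _ => C)
    (Filter.Eventually.of_forall fun n => ?_) (Filter.Eventually.of_forall fun n => ?_)
    intervalIntegrable_const (Filter.Eventually.of_forall fun t _ => tendsto_limAvg ha hs hf _ _)
  · have hc := (iterAvg_lipschitz (a := a) hf n (k + 1)).continuous
    exact Continuous.aestronglyMeasurable (by fun_prop)
  · refine Filter.Eventually.of_forall fun t _ => abs_le.2 ?_
    exact iterAvg_mem_Icc ha hf n (k + 1) _ fun y _ => abs_le.1 (hC y)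

/-- Differentiation removes the outermost average and leaves a difference quotient. Iterating, the
`n`-th derivative costs the factor `∏ 2 / a_{k+i}` and no regularity of `f`. -/
theorem hasDerivAt_limAvg {K : NNReal} (ha : ∀ k, 0 < a k) (hs : Summable a)
    (hf : LipschitzWith K f) {C : ℝ} (hC : ∀ y, |f y| ≤ C) (k : ℕ) (x : ℝ) :
    HasDerivAt (limAvg a f k)
      ((a k)⁻¹ * (limAvg a f (k + 1) (x + a k) - limAvg a f (k + 1) x)) x := by
  have hc := (limAvg_lipschitz ha hs hf (k + 1)).continuous
  have hF : ∀ z : ℝ, HasDerivAt (fun u => ∫ t in (0 : ℝ)..u, limAvg a f (k + 1) t)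
      (limAvg a f (k + 1) z) z := fun z =>
    intervalIntegral.integral_hasDerivAt_right (hc.intervalIntegrable _ _)
      (hc.stronglyMeasurableAtFilter _ _) hc.continuousAt
  have heq : limAvg a f k = fun z => (a k)⁻¹ *
      ((∫ t in (0 : ℝ)..(z + a k), limAvg a f (k + 1) t) -
        ∫ t in (0 : ℝ)..z, limAvg a f (k + 1) t) := by
    funext z
    rw [limAvg_eq_integral ha hs hf hC, intervalIntegral.integral_comp_add_mul _ (ha k).ne',
      intervalIntegral.integral_interval_sub_left (hc.intervalIntegrable _ _)
        (hc.intervalIntegrable _ _)]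
    simp
  rw [heq]
  exact (((hF (x + a k)).comp_add_const x (a k)).sub (hF x)).const_mul _

theorem limAvg_contDiff {K : NNReal} (ha : ∀ k, 0 < a k) (hs : Summable a)
    (hf : LipschitzWith K f) {C : ℝ} (hC : ∀ y, |f y| ≤ C) (n k : ℕ) :
    ContDiff ℝ n (limAvg a f k) := by
  induction n generalizing k with
  | zero => exact contDiff_zero.2 (limAvg_lipschitz ha hs hf k).continuous
  | succ n ih =>
    have hd := hasDerivAt_limAvg ha hs hf hC k
    push_cast
    refine contDiff_succ_iff_deriv.2 ⟨fun x => (hd x).differentiableAt, by simp, ?_⟩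
    rw [show deriv (limAvg a f k) = _ from funext fun x => (hd x).deriv]
    have := ih (k + 1)
    fun_prop

theorem abs_iteratedDeriv_limAvg_le {K : NNReal} (ha : ∀ k, 0 < a k) (hs : Summable a)
    (hf : LipschitzWith K f) {C : ℝ} (hC : ∀ y, |f y| ≤ C) (n k : ℕ) (x : ℝ) :
    |iteratedDeriv n (limAvg a f k) x| ≤ C * ∏ i ∈ Finset.range n, 2 / a (k + i) := by
  induction n generalizing k x with
  | zero =>
    simpa using abs_le.2 (limAvg_mem_Icc ha hs hf x (fun y _ => abs_le.1 (hC y)) k)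
  | succ n ih =>
    have hd := hasDerivAt_limAvg ha hs hf hC k
    have hcd := limAvg_contDiff ha hs hf hC n (k + 1)
    rw [iteratedDeriv_succ', show deriv (limAvg a f k) = _ from funext fun x => (hd x).deriv,
      iteratedDeriv_const_mul_field]
    have hsub : iteratedDeriv n
        (fun x => limAvg a f (k + 1) (x + a k) - limAvg a f (k + 1) x) x =
        iteratedDeriv n (limAvg a f (k + 1)) (x + a k) -
          iteratedDeriv n (limAvg a f (k + 1)) x := by
      have h1 := iteratedDeriv_sub (n := n) (x := x)
        (f := fun x => limAvg a f (k + 1) (x + a k)) (g := limAvg a f (k + 1))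
        (ContDiff.contDiffAt (by fun_prop)) hcd.contDiffAt
      rw [iteratedDeriv_comp_add_const] at h1
      exact h1
    have hprod : ∏ i ∈ Finset.range (n + 1), 2 / a (k + i) =
        (∏ i ∈ Finset.range n, 2 / a (k + 1 + i)) * (2 / a k) := by
      rw [Finset.prod_range_succ']
      congr 1
      exact Finset.prod_congr rfl fun i _ => by rw [add_right_comm, add_assoc]
    have h2 := abs_sub (iteratedDeriv n (limAvg a f (k + 1)) (x + a k))
      (iteratedDeriv n (limAvg a f (k + 1)) x)
    rw [hsub, abs_mul, abs_of_pos (inv_pos.2 (ha k)), hprod]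
    calc _ ≤ (a k)⁻¹ * (C * (∏ i ∈ Finset.range n, 2 / a (k + 1 + i)) +
          C * ∏ i ∈ Finset.range n, 2 / a (k + 1 + i)) :=
          mul_le_mul_of_nonneg_left (h2.trans (add_le_add (ih _ _) (ih _ _)))
            (inv_pos.2 (ha k)).le
      _ = _ := by rw [div_eq_mul_inv 2 (a k)]; ring

end Bump

/-- Iterated averages over intervals of lengths proportional to `M_{j-1} / M_j`, which are summable
by non-quasianalyticity, produce a function of the class `{M_p}`. -/
theorem exists_bump_line (M : WeightSequence) (c : ℝ) {δ : ℝ} (hδ : 0 < δ) :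
    ∃ v : ℝ → ℝ, IsUltra M v ∧ (∀ x, v x ∈ Set.Icc 0 1) ∧ (∀ x, |x - c| ≤ δ → v x = 1) ∧
      ∀ x, 4 * δ ≤ |x - c| → v x = 0 := by
  obtain ⟨-, -, hsum, -⟩ := M.strongNonQuasianalytic
  set S := ∑' j, M j / M (j + 1)
  have hq : ∀ j, 0 < M j / M (j + 1) := fun j => div_pos (M.pos _) (M.pos _)
  have hS : 0 < S := hsum.tsum_pos (fun j => (hq j).le) 0 (hq 0)
  -- scaled so that the intervals have total length `δ`
  set a : ℕ → ℝ := fun j => δ / S * (M j / M (j + 1))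
  have ha : ∀ j, 0 < a j := fun j => mul_pos (div_pos hδ hS) (hq j)
  have has : Summable a := hsum.mul_left _
  have hat : ∑' j, a j = δ := by
    rw [tsum_mul_left]; exact div_mul_cancel₀ _ hS.ne'
  -- a trapezoid, equal to `1` for `|x - c| ≤ 2 δ` and to `0` for `|x - c| ≥ 3 δ`
  set f : ℝ → ℝ := fun x => max 0 (min 1 (3 - δ⁻¹ * |x - c|))
  have hf01 : ∀ x, f x ∈ Set.Icc 0 1 := fun x =>
    ⟨le_max_left _ _, max_le zero_le_one (min_le_left _ _)⟩
  have hf : LipschitzWith (Real.toNNReal δ⁻¹) f := by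
    have h1 : LipschitzWith (Real.toNNReal δ⁻¹) fun x : ℝ => 3 - δ⁻¹ * |x - c| := by
      refine LipschitzWith.of_dist_le_mul fun x y => ?_
      rw [Real.coe_toNNReal _ (inv_pos.2 hδ).le, dist_sub_left, Real.dist_eq, ← mul_sub, abs_mul,
        abs_of_pos (inv_pos.2 hδ), Real.dist_eq]
      refine mul_le_mul_of_nonneg_left ((abs_abs_sub_abs_le _ _).trans_eq ?_) (inv_pos.2 hδ).le
      congr 1; ring
    exact (h1.const_min 1).const_max 0
  have hfC : ∀ y, |f y| ≤ 1 := fun y => abs_le.2 ⟨by linarith [(hf01 y).1], (hf01 y).2⟩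
  refine ⟨limAvg a f 0, ⟨contDiff_infty.2 fun n => limAvg_contDiff ha has hf hfC n 0,
    fun r hr => ?_⟩, fun x => limAvg_mem_Icc ha has hf x (fun y _ => hf01 y) 0, fun x hx => ?_,
    fun x hx => ?_⟩
  · obtain ⟨C, hC0, hC⟩ := pow_le_prod hr (h := 2 * S / δ) (by positivity)
    refine ⟨C, fun n x => ?_⟩
    rw [norm_iteratedFDeriv_eq_norm_iteratedDeriv]
    have h1 := abs_iteratedDeriv_limAvg_le ha has hf hfC n 0 x
    have h2 : ∏ i ∈ Finset.range n, 2 / a (0 + i) = (2 * S / δ) ^ n * M n := by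
      induction n with
      | zero => simp [M.zero]
      | succ n ih =>
        have := (M.pos n).ne'
        have := (M.pos (n + 1)).ne'
        rw [Finset.prod_range_succ, ih (abs_iteratedDeriv_limAvg_le ha has hf hfC n 0 x), zero_add]
        simp only [a, pow_succ]
        field_simp
    rw [h2, one_mul] at h1
    refine h1.trans ?_
    have := mul_le_mul_of_nonneg_right (hC n) (M.pos n).le
    unfold weighted
    linarith
  · have := limAvg_mem_Icc ha has hf (p := 1) (q := 1) x (fun y hy => ?_) 0
    · exact le_antisymm this.2 this.1
    · rw [hat] at hy
      have h1 : |y - c| ≤ 2 * δ := by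
        rw [abs_le] at hx ⊢
        constructor <;> linarith [hy.1, hy.2]
      have h2 : δ⁻¹ * |y - c| ≤ 2 := by
        rw [inv_mul_le_iff₀ hδ]; linarith
      have : f y = 1 := by
        simp only [f]
        rw [min_eq_left (by linarith), max_eq_right zero_le_one]
      simp [this]
  · have := limAvg_mem_Icc ha has hf (p := 0) (q := 0) x (fun y hy => ?_) 0
    · exact le_antisymm this.2 this.1
    · rw [hat] at hy
      have h1 : 3 * δ ≤ |y - c| := by
        rw [le_abs] at hx ⊢
        rcases hx with hx | hx
        · left; linarith [hy.1]
        · right; linarith [hy.2]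
      have h2 : 3 ≤ δ⁻¹ * |y - c| := by
        rw [le_inv_mul_iff₀ hδ]; linarith
      have : f y = 0 := by
        simp only [f]
        exact max_eq_left ((min_le_right _ _).trans (by linarith))
      simp [this]

end

section

variable {d : ℕ}

/-! ### Cut-off functions -/

/-- A product of bumps in the coordinates: it vanishes off a cube of half-width `4 δ`, which lies in
the ball of radius `4 d δ ≤ ε`. -/
theorem exists_bump (M : WeightSequence) (c : Space d) {ε : ℝ} (hε : 0 < ε) :
    ∃ χ : Space d → ℝ, IsUltra M χ ∧ (∀ x, χ x ∈ Set.Icc 0 1) ∧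
      (∃ δ > 0, ∀ x ∈ Metric.ball c δ, χ x = 1) ∧ ∀ x ∉ Metric.closedBall c ε, χ x = 0 := by
  set δ : ℝ := ε / (4 * (d + 1))
  have hδ : 0 < δ := by positivity
  choose v hv hv01 hv1 hv0 using fun i : Fin d => exists_bump_line M (c i) hδ
  refine ⟨fun x => ∏ i, v i (EuclideanSpace.proj (𝕜 := ℝ) i x),
    IsUltra.prod _ fun i _ => (hv i).comp_clm _, fun x =>
      ⟨Finset.prod_nonneg fun i _ => (hv01 i _).1,
        Finset.prod_le_one (fun i _ => (hv01 i _).1) fun i _ => (hv01 i _).2⟩,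
    ⟨δ, hδ, fun x hx => ?_⟩, fun x hx => ?_⟩
  · refine Finset.prod_eq_one fun i _ => hv1 i _ ?_
    have h1 := PiLp.norm_apply_le (x - c) i
    rw [mem_ball_iff_norm] at hx
    exact h1.trans hx.le
  · have hex : ∃ i, 4 * δ ≤ |x i - c i| := by
      by_contra! hcon
      refine hx ?_
      rw [mem_closedBall_iff_norm]
      have hsum : ‖x - c‖ ≤ ∑ i, |x i - c i| := by
        have h := (EuclideanSpace.basisFun (Fin d) ℝ).sum_repr (x - c)
        conv_lhs => rw [← h]
        refine (norm_sum_le _ _).trans (Finset.sum_le_sum fun i _ => ?_)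
        simp [norm_smul]
      calc ‖x - c‖ ≤ ∑ i : Fin d, |x i - c i| := hsum
        _ ≤ ∑ _i : Fin d, 4 * δ := Finset.sum_le_sum fun i _ => (hcon i).le
        _ = d * (4 * δ) := by simp
        _ ≤ (d + 1) * (4 * δ) := by nlinarith
        _ = ε := by simp only [δ]; field_simp
    obtain ⟨i, hi⟩ := hex
    exact Finset.prod_eq_zero (Finset.mem_univ i) (hv0 i _ hi)

/-- A compact subset of an open set has a cut-off function of class `{M_p}`: if the bumps `χ_j` are
equal to `1` on the members of a cover, then so is `1 - ∏ (1 - χ_j)` on the union. -/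
theorem exists_cutoff (M : WeightSequence) {Ω K : Set (Space d)} (hΩ : IsOpen Ω)
    (hK : IsCompact K) (hKΩ : K ⊆ Ω) :
    ∃ χ : Space d → ℂ, IsUltra M χ ∧ IsCompact (tsupport χ) ∧ tsupport χ ⊆ Ω ∧
      ∀ x ∈ K, χ x = 1 := by
  have hball : ∀ c : K, ∃ ε : ℝ, 0 < ε ∧ Metric.closedBall (c : Space d) ε ⊆ Ω := fun c =>
    Metric.nhds_basis_closedBall.mem_iff.1 (hΩ.mem_nhds (hKΩ c.2))
  choose ε hε hεΩ using hball
  choose χ hχ hχ01 hχ1 hχ0 using fun c : K => exists_bump M (c : Space d) (hε c)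
  choose δ hδ hδ1 using hχ1
  obtain ⟨t, ht⟩ := hK.elim_finite_subcover (fun c : K => Metric.ball (c : Space d) (δ c))
    (fun c => Metric.isOpen_ball) fun x hx =>
      Set.mem_iUnion.2 ⟨⟨x, hx⟩, Metric.mem_ball_self (hδ _)⟩
  set θ : Space d → ℝ := fun x => 1 - ∏ c ∈ t, (1 - χ c x)
  have hθ : IsUltra M θ :=
    (IsUltra.const 1).sub (IsUltra.prod t fun c _ => (IsUltra.const 1).sub (hχ c))
  set L : Set (Space d) := ⋃ c ∈ t, Metric.closedBall (c : Space d) (ε c)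
  have hL : IsCompact L := t.isCompact_biUnion fun c _ => isCompact_closedBall _ _
  have hsub : tsupport (fun x => Complex.ofRealCLM (θ x)) ⊆ L := by
    refine closure_minimal (fun x hx => ?_) hL.isClosed
    by_contra hxL
    refine hx ?_
    have : ∀ c ∈ t, 1 - χ c x = 1 := fun c hc => by
      rw [hχ0 c x fun h => hxL (Set.mem_biUnion hc h), sub_zero]
    simp [θ, Finset.prod_congr rfl this]
  refine ⟨fun x => Complex.ofRealCLM (θ x), hθ.clm_comp _,
    hL.of_isClosed_subset (isClosed_tsupport _) hsub,
    hsub.trans (Set.iUnion₂_subset fun c _ => hεΩ c), fun x hx => ?_⟩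
  obtain ⟨c, hc, hxc⟩ := Set.mem_iUnion₂.1 (ht hx)
  have : ∏ c ∈ t, (1 - χ c x) = 0 := Finset.prod_eq_zero hc (by rw [hδ1 c x hxc, sub_self])
  simp [θ, this]

/-! ### Norms by partial derivatives and by full derivatives -/

theorem ultraNorm_le (M : WeightSequence) {K : Set (Space d)} {r : ℕ → ℝ} (hr : r ∈ seqR)
    {f : Space d → ℂ} {A : ℝ}
    (h : ∀ x ∈ K, ∀ n, ‖iteratedFDeriv ℝ n f x‖ ≤ A * weighted M r n) :
    ultraNorm M K r f ≤ ENNReal.ofReal A := by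
  refine iSup₂_le fun x hx => iSup_le fun α => ENNReal.ofReal_le_ofReal ?_
  rw [div_le_iff₀ (weighted_pos M hr _)]
  refine le_trans ?_ (h x hx _)
  refine (ContinuousMultilinearMap.le_opNorm _ _).trans_eq ?_
  simp

theorem norm_partialDeriv_le (M : WeightSequence) {K : Set (Space d)} {r : ℕ → ℝ}
    (hr : r ∈ seqR) {f : Space d → ℂ} {A : ℝ} (hA : 0 ≤ A)
    (h : ultraNorm M K r f ≤ ENNReal.ofReal A) {x : Space d} (hx : x ∈ K) (α : Fin d → ℕ) :
    ‖partialDeriv α f x‖ ≤ A * weighted M r (∑ i, α i) := by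
  rw [← div_le_iff₀ (weighted_pos M hr _), ← ENNReal.ofReal_le_ofReal_iff hA]
  exact (le_iSup₂_of_le x hx (le_iSup (fun α : Fin d → ℕ =>
    ENNReal.ofReal (‖partialDeriv α f x‖ / weighted M r (∑ i, α i))) α)).trans h

section Symmetry

variable {E : Type*} [NormedAddCommGroup E] [NormedSpace ℝ E]
  {F : Type*} [NormedAddCommGroup F] [NormedSpace ℝ F]

/-- The derivative of `f` successively in the directions of a list, the last one first. -/
def dirDeriv (f : E → F) : List E → E → F
  | [] => f
  | v :: l => fun x => fderiv ℝ (dirDeriv f l) x v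

theorem dirDeriv_contDiffOn {f : E → F} {s : Set E} (hs : IsOpen s) (hf : ContDiffOn ℝ ∞ f s)
    (l : List E) : ContDiffOn ℝ ∞ (dirDeriv f l) s := by
  induction l with
  | nil => exact hf
  | cons v l ih => exact (ih.fderiv_of_isOpen hs (by simp)).clm_apply contDiffOn_const

theorem dirDeriv_perm {f : E → F} {s : Set E} (hs : IsOpen s) (hf : ContDiffOn ℝ ∞ f s)
    {l l' : List E} (h : l.Perm l') : Set.EqOn (dirDeriv f l) (dirDeriv f l') s := by
  induction h with
  | nil => exact fun _ _ => rfl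
  | cons v _ ih =>
    intro x hx
    have := (ih.eventuallyEq_of_mem (hs.mem_nhds hx)).fderiv_eq (𝕜 := ℝ)
    exact congrArg (fun T : E →L[ℝ] F => T v) this
  | swap v w l =>
    intro x hx
    have hg := dirDeriv_contDiffOn hs hf l
    have hgx := hg.contDiffAt (hs.mem_nhds hx)
    have hd : DifferentiableAt ℝ (fderiv ℝ (dirDeriv f l)) x :=
      ((hg.fderiv_of_isOpen hs (m := ∞) (by simp)).contDiffAt (hs.mem_nhds hx)).differentiableAt
        (by simp)
    have hsymm := (hgx.isSymmSndFDerivAt (by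
      rw [minSmoothness_of_isRCLikeNormedField]; exact WithTop.coe_le_coe.2 le_top)).eq v w
    have hcomp : ∀ a b : E, fderiv ℝ (fun y => fderiv ℝ (dirDeriv f l) y a) x b =
        fderiv ℝ (fderiv ℝ (dirDeriv f l)) x b a := fun a b => by
      rw [fderiv_clm_apply hd (differentiableAt_const a)]
      simp
    simp only [dirDeriv]
    rw [hcomp, hcomp, hsymm]
  | trans _ _ h₁ h₂ => exact h₁.trans h₂

theorem iteratedFDeriv_eq_dirDeriv {f : E → F} {s : Set E} (hs : IsOpen s)
    (hf : ContDiffOn ℝ ∞ f s) (n : ℕ) {x : E} (hx : x ∈ s) (v : Fin n → E) :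
    iteratedFDeriv ℝ n f x v = dirDeriv f (List.ofFn v) x := by
  induction n generalizing x with
  | zero => simp [dirDeriv]
  | succ n ih =>
    have hd : DifferentiableAt ℝ (iteratedFDeriv ℝ n f) x :=
      (hf.contDiffAt (hs.mem_nhds hx)).differentiableAt_iteratedFDeriv
        (by exact_mod_cast WithTop.coe_lt_coe.2 (ENat.natCast_lt_top n))
    rw [hd.iteratedFDeriv_succ_apply_left', List.ofFn_succ]
    have heq : (fun y => iteratedFDeriv ℝ n f y (Fin.tail v)) =ᶠ[nhds x]
        dirDeriv f (List.ofFn (Fin.tail v)) :=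
      Filter.eventuallyEq_of_mem (hs.mem_nhds hx) fun y hy => ih hy _
    rw [heq.fderiv_eq]
    rfl

/-- The symmetry of higher derivatives of smooth functions, for a reindexing of the directions. -/
theorem iteratedFDeriv_comp_equiv {f : E → F} {s : Set E} (hs : IsOpen s)
    (hf : ContDiffOn ℝ ∞ f s) {x : E} (hx : x ∈ s) {n m : ℕ} (e : Fin n ≃ Fin m)
    (w : Fin m → E) : iteratedFDeriv ℝ n f x (w ∘ e) = iteratedFDeriv ℝ m f x w := by
  obtain rfl : n = m := by simpa using Fintype.card_congr e
  rw [iteratedFDeriv_eq_dirDeriv hs hf n hx, iteratedFDeriv_eq_dirDeriv hs hf n hx]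
  exact dirDeriv_perm hs hf (Equiv.Perm.ofFn_comp_perm e w) hx

end Symmetry

/-- By the symmetry of higher derivatives, the value of the `n`-th derivative on any list of basis
vectors is a partial derivative. -/
theorem exists_partialDeriv_eq {f : Space d → ℂ} {s : Set (Space d)} (hs : IsOpen s)
    (hf : ContDiffOn ℝ ∞ f s) {x : Space d} (hx : x ∈ s) {n : ℕ} (v : Fin n → Fin d) :
    ∃ α : Fin d → ℕ, ∑ i, α i = n ∧
      iteratedFDeriv ℝ n f x (fun j => EuclideanSpace.basisFun (Fin d) ℝ (v j)) =
        partialDeriv α f x := by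
  classical
  set α : Fin d → ℕ := fun i => Fintype.card {j // v j = i}
  let e : Fin n ≃ Fin (∑ i, α i) :=
    ((Equiv.sigmaFiberEquiv v).symm.trans
      (Equiv.sigmaCongrRight fun i => Fintype.equivFin {j // v j = i})).trans finSigmaFinEquiv
  have he : ∀ j, (finSigmaFinEquiv.symm (e j)).1 = v j := fun j => by
    simp [e, Equiv.sigmaFiberEquiv]
  refine ⟨α, by simpa using (Fintype.card_congr e).symm, ?_⟩
  unfold partialDeriv
  rw [← iteratedFDeriv_comp_equiv hs hf hx e]
  congr 1
  funext j
  rw [Function.comp_apply, he]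

/-- Expanding the arguments of the `n`-th derivative in the basis produces `d ^ n` partial
derivatives, so a factor `d` enters the weight sequence; `d + 1` keeps it positive for `d = 0`. -/
theorem norm_iteratedFDeriv_le_of_ultraNorm_le (M : WeightSequence) {K : Set (Space d)} {r : ℕ → ℝ}
    (hr : r ∈ seqR) {f : Space d → ℂ} {A : ℝ} (hA : 0 ≤ A)
    (h : ultraNorm M K r f ≤ ENNReal.ofReal A) {s : Set (Space d)} (hs : IsOpen s)
    (hf : ContDiffOn ℝ ∞ f s) {x : Space d} (hx : x ∈ K) (hxs : x ∈ s) (n : ℕ) :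
    ‖iteratedFDeriv ℝ n f x‖ ≤ A * weighted M (fun i => (d + 1) * r i) n := by
  have hw := weighted_pos M hr n
  rw [weighted_const_mul]
  refine ContinuousMultilinearMap.opNorm_le_bound (by positivity) fun m => ?_
  have hm : m = fun j => ∑ i, m j i • EuclideanSpace.basisFun (Fin d) ℝ i := by
    funext j
    exact ((EuclideanSpace.basisFun (Fin d) ℝ).sum_repr (m j)).symm
  conv_lhs => rw [hm]
  rw [ContinuousMultilinearMap.map_sum]
  calc _ ≤ ∑ _v : Fin n → Fin d, A * weighted M r n * ∏ j, ‖m j‖ := by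
        refine (norm_sum_le _ _).trans (Finset.sum_le_sum fun v _ => ?_)
        rw [ContinuousMultilinearMap.map_smul_univ, norm_smul]
        obtain ⟨α, hα, hpd⟩ := exists_partialDeriv_eq hs hf hxs v
        rw [hpd, mul_comm, norm_prod]
        refine mul_le_mul ?_ (Finset.prod_le_prod (fun _ _ => norm_nonneg _) fun j _ =>
          PiLp.norm_apply_le (m j) (v j)) (Finset.prod_nonneg fun _ _ => norm_nonneg _)
          (by positivity)
        rw [← hα]
        exact norm_partialDeriv_le M hr hA h hx α
    _ = (d : ℝ) ^ n * (A * weighted M r n * ∏ j, ‖m j‖) := by simp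
    _ ≤ ((d : ℝ) + 1) ^ n * (A * weighted M r n * ∏ j, ‖m j‖) := by
        have : 0 ≤ ∏ j, ‖m j‖ := Finset.prod_nonneg fun _ _ => norm_nonneg _
        gcongr
        linarith
    _ = _ := by ring

end

section

variable {d : ℕ}

theorem IsUltra.ultraNorm_lt_top {M : WeightSequence} {f : Space d → ℂ} (hf : IsUltra M f)
    (K : Set (Space d)) {r : ℕ → ℝ} (hr : r ∈ seqR) : ultraNorm M K r f < ⊤ := by
  obtain ⟨C, hC⟩ := hf.2 r hr
  exact (ultraNorm_le M hr fun x _ n => hC n x).trans_lt ENNReal.ofReal_lt_top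

theorem IsUltra.mem_testSpaceOn {M : WeightSequence} {f : Space d → ℂ} (hf : IsUltra M f)
    {K : Set (Space d)} (hK : tsupport f ⊆ K) : f ∈ testSpaceOn M K :=
  ⟨hf.1, hK, fun _ hr => hf.ultraNorm_lt_top K hr⟩

/-! ### Exponentials -/

theorem iteratedDeriv_fourierChar (n : ℕ) :
    iteratedDeriv n (fun t : ℝ => (Real.fourierChar t : ℂ)) =
      fun t : ℝ => (2 * Real.pi * Complex.I) ^ n * (Real.fourierChar t : ℂ) := by
  induction n with
  | zero => simp
  | succ n ih =>
    rw [iteratedDeriv_succ, ih]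
    funext t
    rw [((Real.hasDerivAt_fourierChar t).const_mul _).deriv]
    ring

theorem contDiff_fourierChar : ContDiff ℝ ∞ (fun t : ℝ => (Real.fourierChar t : ℂ)) := by
  simp only [Real.fourierChar_apply]
  have : ContDiff ℝ ∞ (fun t : ℝ => ((2 * Real.pi * t : ℝ) : ℂ)) :=
    Complex.ofRealCLM.contDiff.comp (contDiff_const.mul contDiff_id)
  exact (this.mul contDiff_const).cexp

/-- The exponential `x ↦ exp(-2πi⟨x, ξ⟩)`. -/
def wave (ξ x : Space d) : ℂ := (Real.fourierChar (-inner ℝ x ξ) : ℂ)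

theorem wave_eq_comp (ξ : Space d) :
    wave ξ = (fun t : ℝ => (Real.fourierChar t : ℂ)) ∘ (-(innerSL ℝ ξ)) := by
  funext x
  simp [wave, real_inner_comm]

theorem contDiff_wave (ξ : Space d) : ContDiff ℝ ∞ (wave ξ) := by
  rw [wave_eq_comp]
  exact contDiff_fourierChar.comp (ContinuousLinearMap.contDiff _)

theorem norm_iteratedFDeriv_wave_le (ξ x : Space d) (n : ℕ) :
    ‖iteratedFDeriv ℝ n (wave ξ) x‖ ≤ (2 * Real.pi) ^ n * ‖ξ‖ ^ n := by
  rw [wave_eq_comp, (-(innerSL ℝ ξ)).iteratedFDeriv_comp_right contDiff_fourierChar x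
    (i := n) (by exact_mod_cast le_top)]
  refine (ContinuousMultilinearMap.norm_compContinuousLinearMap_le _ _).trans_eq ?_
  rw [norm_iteratedFDeriv_eq_norm_iteratedDeriv, iteratedDeriv_fourierChar]
  simp [abs_of_pos Real.pi_pos, mul_pow, Circle.norm_coe]

theorem norm_iteratedFDeriv_wave_le_weighted (M : WeightSequence) {r : ℕ → ℝ} (hr : r ∈ seqR)
    (ξ x : Space d) (n : ℕ) :
    ‖iteratedFDeriv ℝ n (wave ξ) x‖ ≤
      Real.exp (assocFun M r ‖ξ‖) * weighted M (fun i => 2 * Real.pi * r i) n := by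
  rw [weighted_const_mul]
  have h := pow_le_weighted_mul_exp M hr (norm_nonneg ξ) n
  calc _ ≤ (2 * Real.pi) ^ n * ‖ξ‖ ^ n := norm_iteratedFDeriv_wave_le ξ x n
    _ ≤ (2 * Real.pi) ^ n * (weighted M r n * Real.exp (assocFun M r ‖ξ‖)) := by gcongr
    _ = _ := by ring

theorem isUltra_wave (M : WeightSequence) (ξ : Space d) : IsUltra M (wave ξ) := by
  refine ⟨contDiff_wave ξ, fun r hr => ⟨Real.exp (assocFun M (fun i => (2 * Real.pi)⁻¹ * r i) ‖ξ‖),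
    fun n x => ?_⟩⟩
  have := norm_iteratedFDeriv_wave_le_weighted M
    (const_mul_mem_seqR (c := (2 * Real.pi)⁻¹) (by positivity) hr) ξ x n
  have h2 : (fun i => 2 * Real.pi * ((2 * Real.pi)⁻¹ * r i)) = r := by
    funext i; exact mul_inv_cancel_left₀ (by positivity) _
  rwa [h2] at this

/-- The norms of `χ exp(-2πi⟨·, ξ⟩)` grow at most like `exp N(|ξ|)` for a suitable sequence. -/
theorem exists_ultraNorm_mul_wave_le {M : WeightSequence} {χ : Space d → ℂ} (hχ : IsUltra M χ)
    {l : ℕ → ℝ} (hl : l ∈ seqR) : ∃ s ∈ seqR, ∃ C : ℝ, 0 ≤ C ∧ ∀ (ξ : Space d) (K : Set (Space d)),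
      ultraNorm M K l (fun x => χ x * wave ξ x) ≤
        ENNReal.ofReal (C * Real.exp (assocFun M s ‖ξ‖)) := by
  have h2 : (fun i => 2⁻¹ * l i) ∈ seqR := const_mul_mem_seqR (by norm_num) hl
  have hs : (fun i => (2 * Real.pi)⁻¹ * (2⁻¹ * l i)) ∈ seqR :=
    const_mul_mem_seqR (by positivity) h2
  obtain ⟨C, hC⟩ := hχ.2 _ h2
  have hC0 : 0 ≤ C := by simpa [weighted_zero] using (norm_nonneg _).trans (hC 0 0)
  refine ⟨_, hs, C, hC0, fun ξ K => ultraNorm_le M hl fun x _ n => ?_⟩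
  have hw : ∀ n, ‖iteratedFDeriv ℝ n (wave ξ) x‖ ≤ Real.exp (assocFun M
      (fun i => (2 * Real.pi)⁻¹ * (2⁻¹ * l i)) ‖ξ‖) * weighted M (fun i => 2⁻¹ * l i) n := by
    intro n
    have := norm_iteratedFDeriv_wave_le_weighted M hs ξ x n
    have h2 : (fun i => 2 * Real.pi * ((2 * Real.pi)⁻¹ * (2⁻¹ * l i))) = fun i => 2⁻¹ * l i := by
      funext i; exact mul_inv_cancel_left₀ (by positivity) _
    rwa [h2] at this
  have := norm_iteratedFDeriv_mul_le_weighted M h2 isOpen_univ (Set.mem_univ x)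
    hχ.1.contDiffOn (contDiff_wave ξ).contDiffOn (fun n => hC n x) hw n
  simpa using this

theorem fourier_eq_integral_mul_wave (f : Space d → ℂ) (ξ : Space d) :
    𝓕 f ξ = ∫ x, f x * wave ξ x := by
  rw [Real.fourier_eq]
  refine integral_congr_ae (Filter.Eventually.of_forall fun x => ?_)
  simp only [wave, Circle.smul_def, smul_eq_mul]
  ring

/-! ### Decay of Fourier transforms -/

theorem pow_mul_norm_fourier_le {f : Space d → ℂ} (hf : ContDiff ℝ ∞ f)
    (hint : ∀ n, Integrable (iteratedFDeriv ℝ n f)) (n : ℕ) (ξ : Space d) :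
    ‖ξ‖ ^ n * ‖𝓕 f ξ‖ ≤ ∫ x, ‖iteratedFDeriv ℝ n f x‖ := by
  have h1 := congrFun (Real.fourier_iteratedFDeriv (N := ⊤) (by exact_mod_cast hf)
    (fun n _ => hint n) (n := n) le_top) ξ
  have h2 : ‖𝓕 (iteratedFDeriv ℝ n f) ξ‖ ≤ ∫ x, ‖iteratedFDeriv ℝ n f x‖ := by
    rw [Real.fourier_eq]
    refine (norm_integral_le_integral_norm _).trans_eq ?_
    simp
  rw [h1] at h2
  have h3 := (VectorFourier.fourierPowSMulRight (-innerSL ℝ) (𝓕 f) ξ n).le_opNorm fun _ => ξ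
  rw [VectorFourier.fourierPowSMulRight_apply] at h3
  have h0 : 0 ≤ ∫ x, ‖iteratedFDeriv ℝ n f x‖ := integral_nonneg fun _ => norm_nonneg _
  simp only [neg_apply, Finset.prod_const, Finset.card_univ, Fintype.card_fin, norm_smul,
    norm_pow, norm_neg, norm_mul, Complex.norm_I, Complex.norm_real, Real.norm_eq_abs,
    abs_of_pos Real.pi_pos, Complex.norm_ofNat, mul_one] at h3
  change _ * (|inner ℝ ξ ξ| ^ n * _) ≤ _ at h3
  rw [real_inner_self_eq_norm_sq, abs_of_nonneg (sq_nonneg _)] at h3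
  rcases (pow_nonneg (norm_nonneg ξ) n).eq_or_lt with hpos | hpos
  · rwa [← hpos, zero_mul]
  · have h4 : (2 * Real.pi) ^ n * (‖ξ‖ ^ n * ‖𝓕 f ξ‖) ≤
        ‖VectorFourier.fourierPowSMulRight (-innerSL ℝ) (𝓕 f) ξ n‖ := by
      refine le_of_mul_le_mul_right (le_trans (le_of_eq ?_) h3) hpos
      ring
    have h5 : (1 : ℝ) ≤ (2 * Real.pi) ^ n := one_le_pow₀ (by linarith [Real.pi_gt_three])
    calc ‖ξ‖ ^ n * ‖𝓕 f ξ‖ ≤ (2 * Real.pi) ^ n * (‖ξ‖ ^ n * ‖𝓕 f ξ‖) :=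
          le_mul_of_one_le_left (by positivity) h5
      _ ≤ _ := h4.trans h2

/-- Quantitative Paley–Wiener estimate: ultradifferentiable bounds on the support of `f` give
exponential decay of its Fourier transform, measured by the associated function. -/
theorem norm_fourier_le (M : WeightSequence) {f : Space d → ℂ} (hf : ContDiff ℝ ∞ f)
    {K : Set (Space d)} (hK : IsCompact K) (hfK : tsupport f ⊆ K) {r : ℕ → ℝ} (hr : r ∈ seqR)
    {A : ℝ} (hA : 0 ≤ A) (h : ∀ x ∈ K, ∀ n, ‖iteratedFDeriv ℝ n f x‖ ≤ A * weighted M r n)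
    (ξ : Space d) :
    ‖𝓕 f ξ‖ ≤ volume.real K * A * Real.exp (-assocFun M r ‖ξ‖) := by
  have hsupp : ∀ n, ∀ x ∉ K, iteratedFDeriv ℝ n f x = 0 := fun n x hx => by
    by_contra hne
    exact hx (hfK (support_iteratedFDeriv_subset (𝕜 := ℝ) n hne))
  have hcs : HasCompactSupport f := hK.of_isClosed_subset (isClosed_tsupport _) hfK
  have hint : ∀ n, Integrable (iteratedFDeriv ℝ n f) := fun n =>
    (hf.continuous_iteratedFDeriv (m := n)
      (by exact_mod_cast le_top)).integrable_of_hasCompactSupport (hcs.iteratedFDeriv n)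
  refine le_mul_exp_neg_assocFun M hr (norm_nonneg _) (by positivity) fun p => ?_
  refine (pow_mul_norm_fourier_le hf hint p ξ).trans ?_
  rw [← setIntegral_eq_integral_of_forall_compl_eq_zero (s := K) fun x hx => by
    rw [hsupp p x hx, norm_zero]]
  have := norm_setIntegral_le_of_norm_le_const (μ := volume) (s := K)
    (f := fun x => ‖iteratedFDeriv ℝ p f x‖) (C := A * weighted M r p) hK.measure_lt_top
    fun x hx => by simpa using h x hx p
  refine (le_abs_self _).trans (this.trans_eq ?_)
  ring

/-- By (M.2) one half of the decay absorbs `|ξ| ^ n` at the cost of `M_n ∏_{i ≤ n} r_i`, and the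
other half makes the bound integrable. -/
theorem exists_pow_mul_norm_le (M : WeightSequence) {U : Space d → ℂ}
    (h : ∀ r ∈ seqR, ∃ C : ℝ, ∀ ξ, ‖U ξ‖ ≤ C * Real.exp (-assocFun M r ‖ξ‖))
    {r : ℕ → ℝ} (hr : r ∈ seqR) : ∃ C : ℝ, 0 ≤ C ∧ ∀ n ξ,
      ‖ξ‖ ^ n * ‖U ξ‖ ≤ C * weighted M r n * (1 + ‖ξ‖) ^ (-((d + 1 : ℕ) : ℝ)) := by
  obtain ⟨s, hs, c, -, hc⟩ := exists_two_mul_assocFun_le M hr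
  obtain ⟨C, hC⟩ := h s hs
  obtain ⟨D, hD0, hD⟩ := exists_exp_neg_assocFun_le M hr (d + 1)
  have hC0 : 0 ≤ C := by
    have := (norm_nonneg _).trans (hC 0)
    exact nonneg_of_mul_nonneg_left this (Real.exp_pos _)
  refine ⟨C * Real.exp c * D, by positivity, fun n ξ => ?_⟩
  have hw := weighted_pos M hr n
  have h1 := pow_le_weighted_mul_exp M hr (norm_nonneg ξ) n
  have h2 : Real.exp (-assocFun M s ‖ξ‖) ≤
      Real.exp c * Real.exp (-assocFun M r ‖ξ‖) * Real.exp (-assocFun M r ‖ξ‖) := by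
    rw [← Real.exp_add, ← Real.exp_add, Real.exp_le_exp]
    linarith [hc ‖ξ‖ (norm_nonneg ξ)]
  calc ‖ξ‖ ^ n * ‖U ξ‖ ≤ (weighted M r n * Real.exp (assocFun M r ‖ξ‖)) *
        (C * (Real.exp c * Real.exp (-assocFun M r ‖ξ‖) * Real.exp (-assocFun M r ‖ξ‖))) := by
        refine mul_le_mul h1 ((hC ξ).trans (by gcongr)) (norm_nonneg _) (by positivity)
    _ = C * Real.exp c * weighted M r n * Real.exp (-assocFun M r ‖ξ‖) := by
        rw [Real.exp_neg]; field_simp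
    _ ≤ C * Real.exp c * weighted M r n * (D * (1 + ‖ξ‖) ^ (-((d + 1 : ℕ) : ℝ))) := by
        gcongr; exact hD _ (norm_nonneg ξ)
    _ = _ := by ring

theorem integrable_bracket (d : ℕ) :
    Integrable fun ξ : Space d => (1 + ‖ξ‖) ^ (-((d + 1 : ℕ) : ℝ)) :=
  integrable_one_add_norm (by simp)

theorem integrable_pow_mul_norm (M : WeightSequence) {U : Space d → ℂ}
    (hU : AEStronglyMeasurable U)
    (h : ∀ r ∈ seqR, ∃ C : ℝ, ∀ ξ, ‖U ξ‖ ≤ C * Real.exp (-assocFun M r ‖ξ‖)) (n : ℕ) :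
    Integrable fun ξ => ‖ξ‖ ^ n * ‖U ξ‖ := by
  obtain ⟨C, -, hC⟩ := exists_pow_mul_norm_le M h id_mem_seqR
  refine ((integrable_bracket d).const_mul (C * weighted M (fun i => (i : ℝ) + 1) n)).mono'
    (AEStronglyMeasurable.mul (by fun_prop) hU.norm) (Filter.Eventually.of_forall fun ξ => ?_)
  rw [Real.norm_of_nonneg (by positivity)]
  exact hC n ξ

theorem integrable_of_decay (M : WeightSequence) {U : Space d → ℂ}
    (hU : AEStronglyMeasurable U)
    (h : ∀ r ∈ seqR, ∃ C : ℝ, ∀ ξ, ‖U ξ‖ ≤ C * Real.exp (-assocFun M r ‖ξ‖)) : Integrable U := by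
  have := integrable_pow_mul_norm M hU h 0
  simp only [pow_zero, one_mul] at this
  exact (integrable_norm_iff hU).1 this

/-- The converse estimate: a function decaying like `exp (-N_{(r_i)})` for every `(r_i) ∈ 𝓡` has an
ultradifferentiable Fourier transform. -/
theorem isUltra_fourier (M : WeightSequence) {U : Space d → ℂ} (hU : AEStronglyMeasurable U)
    (h : ∀ r ∈ seqR, ∃ C : ℝ, ∀ ξ, ‖U ξ‖ ≤ C * Real.exp (-assocFun M r ‖ξ‖)) :
    IsUltra M (𝓕 U) := by
  have hint := integrable_pow_mul_norm M hU h
  refine ⟨by exact_mod_cast Real.contDiff_fourier (N := ⊤) fun n _ => hint n, fun r hr => ?_⟩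
  obtain ⟨C, hC0, hC⟩ := exists_pow_mul_norm_le M h
    (const_mul_mem_seqR (c := (2 * Real.pi)⁻¹) (by positivity) hr)
  refine ⟨C * ∫ ξ : Space d, (1 + ‖ξ‖) ^ (-((d + 1 : ℕ) : ℝ)), fun n x => ?_⟩
  rw [Real.iteratedFDeriv_fourier (N := ⊤) (fun n _ => hint n) hU le_top, Real.fourier_eq]
  have hw := weighted_pos M hr n
  calc _ ≤ ∫ ξ : Space d, C * weighted M r n * (1 + ‖ξ‖) ^ (-((d + 1 : ℕ) : ℝ)) := by
        refine norm_integral_le_of_norm_le ((integrable_bracket d).const_mul _)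
          (Filter.Eventually.of_forall fun ξ => ?_)
        rw [Circle.norm_smul]
        refine (VectorFourier.norm_fourierPowSMulRight_le _ _ _ _).trans ?_
        have h1 := hC n ξ
        rw [weighted_const_mul] at h1
        have hL : ‖innerSL ℝ (E := Space d)‖ ≤ 1 := norm_innerSL_le ℝ
        calc _ ≤ (2 * Real.pi * 1) ^ n * ‖ξ‖ ^ n * ‖U ξ‖ := by gcongr
          _ = (2 * Real.pi) ^ n * (‖ξ‖ ^ n * ‖U ξ‖) := by ring
          _ ≤ (2 * Real.pi) ^ n * (C * ((2 * Real.pi)⁻¹ ^ n * weighted M r n) *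
              (1 + ‖ξ‖) ^ (-((d + 1 : ℕ) : ℝ))) := by gcongr
          _ = _ := by rw [inv_pow]; field_simp
    _ = _ := by rw [integral_const_mul]; ring

theorem isUltra_fourierInv (M : WeightSequence) {U : Space d → ℂ} (hU : AEStronglyMeasurable U)
    (h : ∀ r ∈ seqR, ∃ C : ℝ, ∀ ξ, ‖U ξ‖ ≤ C * Real.exp (-assocFun M r ‖ξ‖)) :
    IsUltra M (𝓕⁻ U) := by
  have := (isUltra_fourier M hU h).comp_clm (-(ContinuousLinearMap.id ℝ (Space d)))
  convert this using 1
  funext x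
  simp [Real.fourierInv_eq_fourier_neg]

theorem integral_fourier_mul_eq {f g : Space d → ℂ} (hf : Integrable f) (hg : Integrable g) :
    ∫ ξ, 𝓕 f ξ * g ξ = ∫ x, f x * 𝓕 g x := by
  simpa using! VectorFourier.integral_fourierIntegral_smul_eq_flip (L := innerₗ (Space d))
    Real.continuous_fourierChar continuous_inner hf hg

end

section

variable {d : ℕ}

/-! ### Localised products -/

section Localisation

theorem contDiff_mul_of_tsupport_subset {χ f : Space d → ℂ} {Ω : Set (Space d)} (hΩ : IsOpen Ω)
    (hχ : ContDiff ℝ ∞ χ) (hsupp : tsupport χ ⊆ Ω) (hf : ContDiffOn ℝ ∞ f Ω) :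
    ContDiff ℝ ∞ fun x => χ x * f x := by
  refine contDiff_iff_contDiffAt.2 fun x => ?_
  by_cases hx : x ∈ tsupport χ
  · exact hχ.contDiffAt.mul (hf.contDiffAt (hΩ.mem_nhds (hsupp hx)))
  · refine (contDiffAt_const (c := (0 : ℂ))).congr_of_eventuallyEq ?_
    filter_upwards [notMem_tsupport_iff_eventuallyEq.1 hx] with y hy
    simp [hy]

theorem tsupport_mul_subset (χ f : Space d → ℂ) : tsupport (fun x => χ x * f x) ⊆ tsupport χ :=
  closure_mono fun x hx => by
    rw [Function.mem_support] at hx ⊢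
    exact left_ne_zero_of_mul hx

theorem isUltra_of_mem_testSpaceOn {M : WeightSequence} {K : Set (Space d)} {φ : Space d → ℂ}
    (hφ : φ ∈ testSpaceOn M K) : IsUltra M φ := by
  refine ⟨hφ.1, fun r hr => ?_⟩
  have hr' := const_mul_mem_seqR (c := ((d : ℝ) + 1)⁻¹) (by positivity) hr
  have htop := hφ.2.2 _ hr'
  refine ⟨(ultraNorm M K (fun i => ((d : ℝ) + 1)⁻¹ * r i) φ).toReal, fun n x => ?_⟩
  by_cases hx : x ∈ K
  · have := norm_iteratedFDeriv_le_of_ultraNorm_le M hr' ENNReal.toReal_nonneg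
      (ENNReal.ofReal_toReal htop.ne).ge isOpen_univ hφ.1.contDiffOn hx (Set.mem_univ x) n
    have h2 : (fun i => ((d : ℝ) + 1) * (((d : ℝ) + 1)⁻¹ * r i)) = r := by
      funext i; exact mul_inv_cancel_left₀ (by positivity) _
    rwa [h2] at this
  · have h0 : iteratedFDeriv ℝ n φ x = 0 := by
      by_contra hne
      exact hx (hφ.2.1 (support_iteratedFDeriv_subset (𝕜 := ℝ) n hne))
    rw [h0, norm_zero]
    exact mul_nonneg ENNReal.toReal_nonneg (weighted_pos M hr n).le

theorem pairing_eq_integral {Ω : TopologicalSpace.Opens (Space d)} {f φ : Space d → ℂ}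
    (h : ∀ x ∉ Ω, φ x = 0) : pairing Ω f φ = ∫ x, f x * φ x :=
  setIntegral_eq_integral_of_forall_compl_eq_zero fun x hx => by rw [h x hx, mul_zero]

theorem pairing_eq_setIntegral {Ω : TopologicalSpace.Opens (Space d)} {f φ : Space d → ℂ}
    {K : Set (Space d)} (hK : K ⊆ Ω) (h : ∀ x ∉ K, φ x = 0) :
    pairing Ω f φ = ∫ x in K, f x * φ x := by
  rw [pairing_eq_integral fun x hx => h x fun hxK => hx (hK hxK),
    setIntegral_eq_integral_of_forall_compl_eq_zero fun x hx => by rw [h x hx, mul_zero]]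

theorem eq_zero_of_tsupport_subset {φ : Space d → ℂ} {K : Set (Space d)} (h : tsupport φ ⊆ K)
    {x : Space d} (hx : x ∉ K) : φ x = 0 :=
  image_eq_zero_of_notMem_tsupport fun hx' => hx (h hx')

theorem norm_le_of_ultraNorm_le (M : WeightSequence) {K : Set (Space d)} {r : ℕ → ℝ}
    (hr : r ∈ seqR) {f : Space d → ℂ} {A : ℝ} (hA : 0 ≤ A)
    (h : ultraNorm M K r f ≤ ENNReal.ofReal A) {s : Set (Space d)} (hs : IsOpen s)
    (hf : ContDiffOn ℝ ∞ f s) (hKs : K ⊆ s) {x : Space d} (hx : x ∈ K) : ‖f x‖ ≤ A := by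
  have := norm_iteratedFDeriv_le_of_ultraNorm_le M hr hA h hs hf hx (hKs hx) 0
  simpa [weighted_zero] using this

/-- The pairing of two functions is controlled by their norms on a compact support. -/
theorem norm_pairing_le (M : WeightSequence) {Ω : TopologicalSpace.Opens (Space d)}
    {K : Set (Space d)} (hK : IsCompact K) (hKΩ : K ⊆ Ω) {f φ : Space d → ℂ}
    (hf : ContDiffOn ℝ ∞ f Ω) (hφ : φ ∈ testSpaceOn M K) {h l : ℕ → ℝ} (hh : h ∈ seqR)
    (hl : l ∈ seqR) {A B : ℝ} (hA : 0 ≤ A) (hB : 0 ≤ B)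
    (hfA : ultraNorm M K h f ≤ ENNReal.ofReal A) (hφB : ultraNorm M K l φ ≤ ENNReal.ofReal B) :
    ‖pairing Ω f φ‖ ≤ volume.real K * A * B := by
  rw [pairing_eq_setIntegral hKΩ fun x hx => eq_zero_of_tsupport_subset hφ.2.1 hx]
  refine (norm_setIntegral_le_of_norm_le_const (C := A * B) hK.measure_lt_top
    fun x hx => ?_).trans_eq (by ring)
  rw [norm_mul]
  exact mul_le_mul (norm_le_of_ultraNorm_le M hh hA hfA Ω.isOpen hf hKΩ hx)
    (norm_le_of_ultraNorm_le M hl hB hφB isOpen_univ hφ.1.contDiffOn (Set.subset_univ _) hx)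
    (norm_nonneg _) hA

theorem pairing_sub_left {M : WeightSequence} {Ω : TopologicalSpace.Opens (Space d)}
    {K : Set (Space d)} (hK : IsCompact K) (hKΩ : K ⊆ Ω) {f g φ : Space d → ℂ}
    (hf : ContDiffOn ℝ ∞ f Ω) (hg : ContDiffOn ℝ ∞ g Ω) (hφ : φ ∈ testSpaceOn M K) :
    pairing Ω (f - g) φ = pairing Ω f φ - pairing Ω g φ := by
  have h0 : ∀ x ∉ K, φ x = 0 := fun x hx => eq_zero_of_tsupport_subset hφ.2.1 hx
  have hint : ∀ {p : Space d → ℂ}, ContDiffOn ℝ ∞ p Ω →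
      IntegrableOn (fun x => p x * φ x) K := fun hp =>
    ((hp.continuousOn.mono hKΩ).mul hφ.1.continuous.continuousOn).integrableOn_compact hK
  rw [pairing_eq_setIntegral hKΩ h0, pairing_eq_setIntegral hKΩ h0,
    pairing_eq_setIntegral hKΩ h0, ← integral_sub (hint hf) (hint hg)]
  refine integral_congr_ae (Filter.Eventually.of_forall fun x => ?_)
  simp only [Pi.sub_apply]
  ring

end Localisation

/-- The scale at which the two error terms balance: from `F_ε - U = O(exp (N_s(|ξ|) - N_b(1/ε)))`
and `F_ε = O(exp (N_k(1/ε) - N_h(|ξ|)))` for all `(h_i) ∈ 𝓡`, the choice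
`N_b(1/ε) = N_s(|ξ|) + N_r(|ξ|)` gives the decay `exp (-N_r(|ξ|))` of `U`. -/
theorem exists_decay (M : WeightSequence) {F : Eps → Space d → ℂ} {U : Space d → ℂ}
    {b k s : ℕ → ℝ} (hb : b ∈ seqR) (hk : k ∈ seqR) (hs : s ∈ seqR) (hbk : ∀ i, b i ≤ k i)
    {C₁ : ℝ} (hC₁ : 0 ≤ C₁) {ε₁ : Eps}
    (h₁ : ∀ ε < ε₁, ∀ ξ, ‖F ε ξ - U ξ‖ ≤
      C₁ * Real.exp (-assocFun M b (1 / ε)) * Real.exp (assocFun M s ‖ξ‖))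
    (h₂ : ∀ h ∈ seqR, ∃ C : ℝ, 0 ≤ C ∧ ∃ ε₂ : Eps, ∀ ε < ε₂, ∀ ξ, ‖F ε ξ‖ ≤
      C * Real.exp (assocFun M k (1 / ε)) * Real.exp (-assocFun M h ‖ξ‖))
    {r : ℕ → ℝ} (hr : r ∈ seqR) :
    ∃ C : ℝ, ∀ ξ, ‖U ξ‖ ≤ C * Real.exp (-assocFun M r ‖ξ‖) := by
  obtain ⟨h, hh, c, hc, hsr⟩ := exists_assocFun_add_le M hr hs
  obtain ⟨C₂, hC₂, ε₂, h₂⟩ := h₂ h hh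
  -- starting the search at `1/ε = 2 / e` keeps `ε` strictly below both thresholds; this is where
  -- the maximum with the constant `B` comes from
  set e : ℝ := min (ε₁ : ℝ) ε₂
  have he : 0 < e := lt_min ε₁.2.1 ε₂.2.1
  set B := assocFun M b (2 / e)
  refine ⟨C₁ + C₂ * Real.exp (B + c), fun ξ => ?_⟩
  set S := assocFun M s ‖ξ‖
  set R := assocFun M r ‖ξ‖
  have hS : 0 ≤ S := assocFun_nonneg M _ _
  have hR : 0 ≤ R := assocFun_nonneg M _ _
  have hB : 0 ≤ B := assocFun_nonneg M _ _
  obtain ⟨σ, hσ, hσA⟩ := exists_assocFun_eq M hb (A := max (S + R) B) (by positivity : 0 < 2 / e)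
    (le_max_right _ _)
  have hσ0 : 0 < σ := lt_of_lt_of_le (by positivity) hσ
  have hσe : 1 / σ < e := by
    rw [div_le_iff₀ he] at hσ
    rw [div_lt_iff₀ hσ0]
    linarith
  have h1e : 1 / σ < 1 := (hσe.trans_le (min_le_left _ _)).trans ε₁.2.2
  let ε : Eps := ⟨1 / σ, by positivity, h1e⟩
  have hε : 1 / (ε : ℝ) = σ := one_div_one_div σ
  have i₁ := h₁ ε (show (1 / σ : ℝ) < ε₁ from hσe.trans_le (min_le_left _ _)) ξ
  have i₂ := h₂ ε (show (1 / σ : ℝ) < ε₂ from hσe.trans_le (min_le_right _ _)) ξ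
  rw [hε] at i₁ i₂
  rw [hσA] at i₁
  have hkσ : assocFun M k σ ≤ S + R + B := by
    refine (assocFun_le_of_le M hb hk hbk hσ0.le).trans ?_
    rw [hσA]
    exact max_le (by linarith) (by linarith)
  have j₁ : Real.exp (-max (S + R) B) * Real.exp S ≤ Real.exp (-R) := by
    rw [← Real.exp_add, Real.exp_le_exp]
    linarith [le_max_left (S + R) B]
  have j₂ : Real.exp (assocFun M k σ) * Real.exp (-assocFun M h ‖ξ‖) ≤
      Real.exp (B + c) * Real.exp (-R) := by
    rw [← Real.exp_add, ← Real.exp_add, Real.exp_le_exp]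
    linarith [hsr ‖ξ‖ (norm_nonneg ξ)]
  have htri : ‖U ξ‖ ≤ ‖F ε ξ - U ξ‖ + ‖F ε ξ‖ := by
    have := norm_sub_le (F ε ξ) (F ε ξ - U ξ)
    rw [sub_sub_cancel] at this
    linarith
  calc ‖U ξ‖ ≤ C₁ * (Real.exp (-max (S + R) B) * Real.exp S) +
        C₂ * (Real.exp (assocFun M k σ) * Real.exp (-assocFun M h ‖ξ‖)) := by
        linarith [htri, i₁, i₂]
    _ ≤ C₁ * Real.exp (-R) + C₂ * (Real.exp (B + c) * Real.exp (-R)) := by gcongr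
    _ = _ := by ring

/-- Indices tending to zero fast enough that `N_{(b_i)}(1/ε)` tends to infinity. -/
theorem exists_seq_assocFun_ge (M : WeightSequence) {b : ℕ → ℝ} (hb : b ∈ seqR) (ε₀ : Eps) :
    ∃ e : ℕ → Eps, (∀ n, e n < ε₀) ∧ ∀ n : ℕ, (n : ℝ) ≤ assocFun M b (1 / e n) := by
  have h : ∀ n : ℕ, ∃ ε : Eps, ε < ε₀ ∧ (n : ℝ) ≤ assocFun M b (1 / ε) := fun n => by
    have h0 := ε₀.2.1
    obtain ⟨σ, hσ, hσA⟩ := exists_assocFun_eq M hb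
      (A := max n (assocFun M b (2 / ε₀))) (by positivity : 0 < 2 / (ε₀ : ℝ)) (le_max_right _ _)
    have hσ0 : 0 < σ := lt_of_lt_of_le (by positivity) hσ
    have hσe : 1 / σ < ε₀ := by
      rw [div_le_iff₀ h0] at hσ
      rw [div_lt_iff₀ hσ0]
      linarith
    refine ⟨⟨1 / σ, by positivity, hσe.trans ε₀.2.2⟩, hσe, ?_⟩
    change (n : ℝ) ≤ assocFun M b (1 / (1 / σ))
    rw [one_div_one_div, hσA]
    exact le_max_left _ _
  choose e he hge using h
  exact ⟨e, he, hge⟩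

theorem norm_fourierInv_le_of_mem_testSpaceOn {M : WeightSequence} {K : Set (Space d)}
    (hK : IsCompact K) {φ : Space d → ℂ} (hφ : φ ∈ testSpaceOn M K) :
    ∀ r ∈ seqR, ∃ C : ℝ, ∀ ξ, ‖𝓕⁻ φ ξ‖ ≤ C * Real.exp (-assocFun M r ‖ξ‖) := by
  intro r hr
  obtain ⟨A, hA⟩ := (isUltra_of_mem_testSpaceOn hφ).2 r hr
  have hA0 : 0 ≤ A := by simpa [weighted_zero] using (norm_nonneg _).trans (hA 0 0)
  refine ⟨volume.real K * A, fun ξ => ?_⟩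
  have := norm_fourier_le M hφ.1 hK hφ.2.1 hr hA0 (fun x _ n => hA n x) (-ξ)
  rwa [norm_neg, ← Real.fourierInv_eq_fourier_neg] at this

theorem continuous_fourier_of_integrable {f : Space d → ℂ} (hf : Integrable f) :
    Continuous (𝓕 f) :=
  VectorFourier.fourierIntegral_continuous Real.continuous_fourierChar
    (L := innerₗ (Space d)) continuous_inner hf

theorem integral_fourierInv_mul_eq {f g : Space d → ℂ} (hf : Integrable f) (hg : Integrable g) :
    ∫ x, 𝓕⁻ f x * g x = ∫ ξ, f ξ * 𝓕⁻ g ξ := by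
  rw [Real.fourierInv_eq_fourier_comp_neg g, ← integral_fourier_mul_eq hf hg.comp_neg,
    ← integral_neg_eq_self]
  refine integral_congr_ae (Filter.Eventually.of_forall fun x => ?_)
  simp [Real.fourierInv_eq_fourier_neg]

end

section

variable {d : ℕ}

/-! ### Local representation of the ultradistribution -/

variable {M : WeightSequence} {Ω : TopologicalSpace.Opens (Space d)}

/-- The estimate of strong `R`-association on a single compact set `L`. -/
def StrongAssocOn (u : Eps → Space d → ℂ) (T : Ultradistribution M Ω) (L : Set (Space d))
    (b : ℕ → ℝ) : Prop :=
  ∃ l ∈ seqR, ∃ C : ℝ, 0 < C ∧ ∃ ε₀ : Eps, ∀ ε : Eps, ε < ε₀ →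
    ∀ φ : testSpace M Ω, (φ : Space d → ℂ) ∈ testSpaceOn M L →
      ‖pairing Ω (u ε) φ - T.toLin φ‖ₑ ≤
        ENNReal.ofReal (C * Real.exp (-assocFun M b (1 / ε))) * ultraNorm M L l φ

theorem enorm_le_ofReal_mul_iff {z : ℂ} {a : ℝ} (ha : 0 ≤ a) {t : ℝ≥0∞} (ht : t < ⊤) :
    ‖z‖ₑ ≤ ENNReal.ofReal a * t ↔ ‖z‖ ≤ a * t.toReal := by
  rw [← ENNReal.ofReal_toReal ht.ne, ← ENNReal.ofReal_mul ha, ← ofReal_norm,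
    ENNReal.ofReal_le_ofReal_iff (mul_nonneg ha ENNReal.toReal_nonneg),
    ENNReal.toReal_ofReal ENNReal.toReal_nonneg]

/-- Strong association does not depend on the representative. -/
theorem StrongAssocOn.congr {u u' : Eps → Space d → ℂ} {T : Ultradistribution M Ω}
    {L : Set (Space d)} (hL : IsCompact L) (hLΩ : L ⊆ Ω) {b : ℕ → ℝ} (hb : b ∈ seqR)
    (hu : ∀ ε, u ε ∈ ultraDiff M Ω) (hu' : ∀ ε, u' ε ∈ ultraDiff M Ω)
    (hneg : u - u' ∈ negligible M Ω) (h : StrongAssocOn u' T L b) : StrongAssocOn u T L b := by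
  obtain ⟨l, hl, C, hC, ε₀, h⟩ := h
  obtain ⟨D, hD, ε₁, hD'⟩ := hneg.2 L hL hLΩ l hl b hb
  refine ⟨l, hl, C + volume.real L * D, by positivity, min ε₀ ε₁, fun ε hε φ hφ => ?_⟩
  have htop : ultraNorm M L l φ < ⊤ := hφ.2.2 l hl
  set t := (ultraNorm M L l φ).toReal
  have ht : 0 ≤ t := ENNReal.toReal_nonneg
  have h₁ := (enorm_le_ofReal_mul_iff (by positivity) htop).1
    (h ε (hε.trans_le (min_le_left _ _)) φ hφ)
  have h₂ := norm_pairing_le M hL hLΩ ((hu ε).1.sub (hu' ε).1) hφ hl hl (by positivity) ht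
    (hD' ε (hε.trans_le (min_le_right _ _))) (ENNReal.ofReal_toReal htop.ne).ge
  have h₃ := pairing_sub_left hL hLΩ (hu ε).1 (hu' ε).1 hφ
  rw [enorm_le_ofReal_mul_iff (by positivity) htop]
  have h₂' : ‖pairing Ω (u ε) φ - pairing Ω (u' ε) φ‖ ≤
      volume.real L * (D * Real.exp (-assocFun M b (1 / ε))) * t := h₃ ▸ h₂
  calc ‖pairing Ω (u ε) φ - T.toLin φ‖
      ≤ ‖pairing Ω (u ε) φ - pairing Ω (u' ε) φ‖ + ‖pairing Ω (u' ε) φ - T.toLin φ‖ :=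
        norm_sub_le_norm_sub_add_norm_sub _ _ _
    _ ≤ _ := add_le_add h₂' h₁
    _ = _ := by ring

/-- Uniform decay of the Fourier transforms of the localised net `χ u_ε`. -/
theorem exists_norm_fourier_mul_le {u : Eps → Space d → ℂ} (hu : ∀ ε, u ε ∈ ultraDiff M Ω)
    {L : Set (Space d)} (hL : IsCompact L) (hLΩ : L ⊆ Ω) {χ : Space d → ℂ} (hχ : IsUltra M χ)
    (hχL : tsupport χ ⊆ L) {v : Eps → ℝ} (hv : ∀ ε, 0 ≤ v ε)
    (hreg : ∀ h ∈ seqR, IsBigOEps (fun ε => ultraNorm M L h (u ε)) v)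
    {h : ℕ → ℝ} (hh : h ∈ seqR) :
    ∃ C : ℝ, 0 ≤ C ∧ ∃ ε₂ : Eps, ∀ ε < ε₂, ∀ ξ,
      ‖𝓕 (fun x => χ x * u ε x) ξ‖ ≤ C * v ε * Real.exp (-assocFun M h ‖ξ‖) := by
  have h2 : (fun i => 2⁻¹ * h i) ∈ seqR := const_mul_mem_seqR (by norm_num) hh
  have hs : (fun i => ((d : ℝ) + 1)⁻¹ * (2⁻¹ * h i)) ∈ seqR :=
    const_mul_mem_seqR (by positivity) h2
  obtain ⟨A, hA⟩ := hχ.2 _ h2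
  have hA0 : 0 ≤ A := by simpa [weighted_zero] using (norm_nonneg _).trans (hA 0 0)
  obtain ⟨D, hD, ε₂, hDε⟩ := hreg _ hs
  refine ⟨volume.real L * (A * D), by positivity, ε₂, fun ε hε ξ => ?_⟩
  have hvε := hv ε
  have hbound : ∀ x ∈ L, ∀ n, ‖iteratedFDeriv ℝ n (fun x => χ x * u ε x) x‖ ≤
      A * (D * v ε) * weighted M h n := by
    intro x hx n
    have hux : ∀ n, ‖iteratedFDeriv ℝ n (u ε) x‖ ≤
        D * v ε * weighted M (fun i => 2⁻¹ * h i) n := by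
      intro n
      have := norm_iteratedFDeriv_le_of_ultraNorm_le M hs (by positivity) (hDε ε hε) Ω.isOpen
        (hu ε).1 hx (hLΩ hx) n
      have h3 : (fun i => ((d : ℝ) + 1) * (((d : ℝ) + 1)⁻¹ * (2⁻¹ * h i))) =
          fun i => 2⁻¹ * h i := by
        funext i; exact mul_inv_cancel_left₀ (by positivity) _
      rwa [h3] at this
    have := norm_iteratedFDeriv_mul_le_weighted M h2 Ω.isOpen (hLΩ hx)
      hχ.1.contDiffOn (hu ε).1 (fun n => hA n x) hux n
    simpa using this
  have := norm_fourier_le M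
    (contDiff_mul_of_tsupport_subset Ω.isOpen hχ.1 (hχL.trans hLΩ) (hu ε).1) hL
    ((tsupport_mul_subset χ (u ε)).trans hχL) hh (by positivity) hbound ξ
  refine this.trans_eq ?_
  ring

/-- Localised by a cut-off `χ`, the ultradistribution `T` is the inverse Fourier transform of
`ξ ↦ ⟨T, χ exp(-2πi⟨·, ξ⟩)⟩`, whose decay makes it an ultradifferentiable function. -/
theorem exists_local_representation (T : Ultradistribution M Ω) {u : Eps → Space d → ℂ}
    (hu : ∀ ε, u ε ∈ ultraDiff M Ω) {L : Set (Space d)} (hL : IsCompact L) (hLΩ : L ⊆ Ω)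
    {χ : Space d → ℂ} (hχ : IsUltra M χ) (hχL : tsupport χ ⊆ L) {k b : ℕ → ℝ}
    (hk : k ∈ seqR) (hb : b ∈ seqR) (hbk : ∀ i, b i ≤ k i)
    (hreg : ∀ h ∈ seqR, IsBigOEps (fun ε => ultraNorm M L h (u ε))
      (fun ε => Real.exp (assocFun M k (1 / ε))))
    (hassoc : StrongAssocOn u T L b) :
    ∃ f : Space d → ℂ, IsUltra M f ∧ ∀ φ : testSpace M Ω,
      (φ : Space d → ℂ) ∈ testSpaceOn M L → (∀ x, χ x * (φ : Space d → ℂ) x = φ.1 x) →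
        T.toLin φ = pairing Ω f φ := by
  obtain ⟨l, hl, C, hC, ε₁, hT⟩ := hassoc
  obtain ⟨s, hs, C', hC', hwave⟩ := exists_ultraNorm_mul_wave_le hχ hl
  have hmem : ∀ ξ, (fun x => χ x * wave ξ x) ∈ testSpaceOn M L := fun ξ =>
    (hχ.mul (isUltra_wave M ξ)).mem_testSpaceOn ((tsupport_mul_subset _ _).trans hχL)
  set U : Space d → ℂ := fun ξ => T.toLin ⟨fun x => χ x * wave ξ x, L, hL, hLΩ, hmem ξ⟩
  set F : Eps → Space d → ℂ := fun ε => 𝓕 (fun x => χ x * u ε x)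
  have hsmooth : ∀ ε, ContDiff ℝ ∞ fun x => χ x * u ε x := fun ε =>
    contDiff_mul_of_tsupport_subset Ω.isOpen hχ.1 (hχL.trans hLΩ) (hu ε).1
  have hcs : ∀ ε, HasCompactSupport fun x => χ x * u ε x := fun ε =>
    hL.of_isClosed_subset (isClosed_tsupport _) ((tsupport_mul_subset _ _).trans hχL)
  have hintu : ∀ ε, Integrable fun x => χ x * u ε x := fun ε =>
    (hsmooth ε).continuous.integrable_of_hasCompactSupport (hcs ε)
  -- association, tested on `χ` times an exponential
  have h₁ : ∀ ε < ε₁, ∀ ξ, ‖F ε ξ - U ξ‖ ≤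
      C * C' * Real.exp (-assocFun M b (1 / ε)) * Real.exp (assocFun M s ‖ξ‖) := by
    intro ε hε ξ
    have hp : pairing Ω (u ε) (fun x => χ x * wave ξ x) = F ε ξ := by
      rw [pairing_eq_integral fun x hx =>
        eq_zero_of_tsupport_subset (hmem ξ).2.1 fun hxL => hx (hLΩ hxL)]
      simp only [F]
      rw [fourier_eq_integral_mul_wave]
      refine integral_congr_ae (Filter.Eventually.of_forall fun x => ?_)
      beta_reduce
      ring
    have h := hT ε hε ⟨fun x => χ x * wave ξ x, L, hL, hLΩ, hmem ξ⟩ (hmem ξ)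
    have htop : ultraNorm M L l (fun x => χ x * wave ξ x) < ⊤ := (hmem ξ).2.2 l hl
    have h' := (enorm_le_ofReal_mul_iff (by positivity) htop).1 h
    have ht := ENNReal.toReal_le_of_le_ofReal (by positivity) (hwave ξ L)
    rw [← hp]
    calc _ ≤ _ := h'
      _ ≤ C * Real.exp (-assocFun M b (1 / ε)) * (C' * Real.exp (assocFun M s ‖ξ‖)) := by
          gcongr
      _ = _ := by ring
  have hdecay : ∀ r ∈ seqR, ∃ C : ℝ, ∀ ξ, ‖U ξ‖ ≤ C * Real.exp (-assocFun M r ‖ξ‖) :=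
    fun r hr => exists_decay M hb hk hs hbk (by positivity) h₁
      (fun h hh => exists_norm_fourier_mul_le hu hL hLΩ hχ hχL (fun _ => (Real.exp_pos _).le)
        hreg hh) hr
  -- `U` is a pointwise limit of continuous functions, hence measurable
  obtain ⟨e, he, hge⟩ := exists_seq_assocFun_ge M hb ε₁
  have hexp : Filter.Tendsto (fun n => Real.exp (-assocFun M b (1 / e n))) Filter.atTop
      (nhds 0) := by
    refine Real.tendsto_exp_atBot.comp (Filter.tendsto_neg_atTop_atBot.comp ?_)
    exact Filter.tendsto_atTop_mono hge tendsto_natCast_atTop_atTop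
  have hlim : ∀ ξ, Filter.Tendsto (fun n => F (e n) ξ) Filter.atTop (nhds (U ξ)) := by
    intro ξ
    rw [tendsto_iff_norm_sub_tendsto_zero]
    refine squeeze_zero (fun _ => norm_nonneg _) (fun n => h₁ (e n) (he n) ξ) ?_
    simpa using (hexp.const_mul (C * C')).mul_const (Real.exp (assocFun M s ‖ξ‖))
  have hU : AEStronglyMeasurable U := by
    refine aestronglyMeasurable_of_tendsto_ae Filter.atTop (f := fun n => F (e n))
      (fun n => (continuous_fourier_of_integrable (hintu (e n))).aestronglyMeasurable)
      (Filter.Eventually.of_forall hlim)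
  have hUint : Integrable U := integrable_of_decay M hU hdecay
  refine ⟨𝓕⁻ U, isUltra_fourierInv M hU hdecay, fun φ hφ hχφ => ?_⟩
  have hφcs : HasCompactSupport φ.1 := hL.of_isClosed_subset (isClosed_tsupport _) hφ.2.1
  have hφint : Integrable φ.1 := hφ.1.continuous.integrable_of_hasCompactSupport hφcs
  have hφ0 : ∀ x ∉ Ω, φ.1 x = 0 := fun x hx =>
    eq_zero_of_tsupport_subset hφ.2.1 fun hxL => hx (hLΩ hxL)
  have hψ := norm_fourierInv_le_of_mem_testSpaceOn hL hφ
  have hψm : AEStronglyMeasurable (𝓕⁻ φ.1) := by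
    rw [Real.fourierInv_eq_fourier_comp_neg]
    exact (continuous_fourier_of_integrable hφint.comp_neg).aestronglyMeasurable
  have hψint : Integrable (𝓕⁻ φ.1) := integrable_of_decay M hψm hψ
  have hinv : 𝓕 (𝓕⁻ φ.1) = φ.1 := by
    refine hφ.1.continuous.fourier_fourierInv_eq hφint ?_
    have := hψint.comp_neg
    simpa [Real.fourierInv_eq_fourier_neg] using this
  have hpair : ∀ ε, pairing Ω (u ε) φ = ∫ ξ, F ε ξ * 𝓕⁻ φ.1 ξ := by
    intro ε
    rw [pairing_eq_integral hφ0, integral_fourier_mul_eq (hintu ε) hψint, hinv]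
    refine integral_congr_ae (Filter.Eventually.of_forall fun x => ?_)
    beta_reduce
    linear_combination (-(u ε x)) * hχφ x
  have hlim₁ : Filter.Tendsto (fun n => pairing Ω (u (e n)) φ) Filter.atTop
      (nhds (T.toLin φ)) := by
    rw [tendsto_iff_norm_sub_tendsto_zero]
    refine squeeze_zero (fun _ => norm_nonneg _) (fun n =>
      (enorm_le_ofReal_mul_iff (by positivity) (hφ.2.2 l hl)).1 (hT (e n) (he n) φ hφ)) ?_
    simpa using (hexp.const_mul C).mul_const (ultraNorm M L l φ.1).toReal
  have hlim₂ : Filter.Tendsto (fun n => ∫ ξ, F (e n) ξ * 𝓕⁻ φ.1 ξ) Filter.atTop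
      (nhds (∫ ξ, U ξ * 𝓕⁻ φ.1 ξ)) := by
    -- `F_ε` may grow like `exp N_s`, which the decay of `𝓕⁻φ` absorbs
    obtain ⟨h, hh, c, hc, hsh⟩ := exists_assocFun_add_le M id_mem_seqR hs
    obtain ⟨A, hA⟩ := hψ h hh
    obtain ⟨B, hB⟩ := hdecay _ id_mem_seqR
    obtain ⟨D, hD, hDb⟩ := exists_exp_neg_assocFun_le M id_mem_seqR (d + 1)
    have hA0 : 0 ≤ A := nonneg_of_mul_nonneg_left ((norm_nonneg _).trans (hA 0)) (Real.exp_pos _)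
    have hB0 : 0 ≤ B := nonneg_of_mul_nonneg_left ((norm_nonneg _).trans (hB 0)) (Real.exp_pos _)
    refine tendsto_integral_of_dominated_convergence
      (fun ξ => (C * C' + B) * (A * Real.exp c) * (D * (1 + ‖ξ‖) ^ (-((d + 1 : ℕ) : ℝ))))
      (fun n => (continuous_fourier_of_integrable (hintu (e n))).aestronglyMeasurable.mul hψm)
      (((integrable_bracket d).const_mul D).const_mul _)
      (fun n => Filter.Eventually.of_forall fun ξ => ?_)
      (Filter.Eventually.of_forall fun ξ => (hlim ξ).mul_const _)
    set S := assocFun M s ‖ξ‖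
    set R := assocFun M (fun i : ℕ => (i : ℝ) + 1) ‖ξ‖
    have hS : 0 ≤ S := assocFun_nonneg M _ _
    have hR : 0 ≤ R := assocFun_nonneg M _ _
    have hF : ‖F (e n) ξ‖ ≤ (C * C' + B) * Real.exp S := by
      have i₁ : ‖F (e n) ξ - U ξ‖ ≤ C * C' * Real.exp S := by
        refine (h₁ (e n) (he n) ξ).trans ?_
        have : Real.exp (-assocFun M b (1 / e n)) ≤ 1 :=
          Real.exp_le_one_iff.2 (neg_nonpos.2 (assocFun_nonneg M _ _))
        calc _ ≤ C * C' * 1 * Real.exp S := by gcongr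
          _ = _ := by ring
      have i₂ : ‖U ξ‖ ≤ B * Real.exp S := by
        refine (hB ξ).trans ?_
        gcongr
        linarith
      have := norm_add_le (F (e n) ξ - U ξ) (U ξ)
      rw [sub_add_cancel] at this
      linarith
    have hexp' : Real.exp S * Real.exp (-assocFun M h ‖ξ‖) ≤ Real.exp c * Real.exp (-R) := by
      rw [← Real.exp_add, ← Real.exp_add, Real.exp_le_exp]
      linarith [hsh ‖ξ‖ (norm_nonneg ξ)]
    rw [norm_mul]
    calc _ ≤ ((C * C' + B) * Real.exp S) * (A * Real.exp (-assocFun M h ‖ξ‖)) :=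
          mul_le_mul hF (hA ξ) (norm_nonneg _) (by positivity)
      _ = (C * C' + B) * A * (Real.exp S * Real.exp (-assocFun M h ‖ξ‖)) := by ring
      _ ≤ (C * C' + B) * A * (Real.exp c * Real.exp (-R)) := by gcongr
      _ ≤ (C * C' + B) * A * (Real.exp c * (D * (1 + ‖ξ‖) ^ (-((d + 1 : ℕ) : ℝ)))) := by
          gcongr
          exact hDb _ (norm_nonneg ξ)
      _ = _ := by ring
  simp only [hpair] at hlim₁
  rw [tendsto_nhds_unique hlim₁ hlim₂, pairing_eq_integral hφ0,
    integral_fourierInv_mul_eq hUint hφint]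

end

variable {d : ℕ}

variable {M : WeightSequence} {Ω : TopologicalSpace.Opens (Space d)}

/-! ### Gluing -/

/-- Test functions of class `{M_p}` separate continuous functions. -/
theorem eqOn_of_pairing_eq {f g : Space d → ℂ} (hf : Continuous f) (hg : Continuous g)
    {V : Set (Space d)} (hV : IsOpen V) (hVΩ : V ⊆ Ω)
    (h : ∀ K : Set (Space d), IsCompact K → K ⊆ V → ∀ φ ∈ testSpaceOn M K,
      pairing Ω f φ = pairing Ω g φ) : Set.EqOn f g V := by
  intro x hx
  by_contra hne
  -- `q` is positive near `x`, so its integral against a small bump at `x` is positive, while the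
  -- hypothesis makes it vanish
  set w : Space d → ℂ := fun y => f y - g y
  have hw : Continuous w := hf.sub hg
  set q : Space d → ℝ := fun y => (starRingEnd ℂ (w x) * w y).re
  have hq : Continuous q := Complex.continuous_re.comp (continuous_const.mul hw)
  have hqx : 0 < q x := by
    simp only [q]
    rw [← Complex.normSq_eq_conj_mul_self, Complex.ofReal_re]
    exact Complex.normSq_pos.2 (sub_ne_zero.2 hne)
  obtain ⟨ε, hε, hball⟩ := Metric.nhds_basis_closedBall.mem_iff.1
    (Filter.inter_mem (hV.mem_nhds hx) (hq.continuousAt.eventually (lt_mem_nhds hqx)))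
  obtain ⟨χ, hχ, hχ01, ⟨δ, hδ, hχ1⟩, hχ0⟩ := exists_bump M x hε
  have hsub : ∀ {G : Type} [NormedAddCommGroup G] {p : Space d → G},
      (∀ y ∉ Metric.closedBall x ε, p y = 0) → tsupport p ⊆ Metric.closedBall x ε :=
    fun hp => closure_minimal (fun y hy => by_contra fun hn => hy (hp y hn))
      Metric.isClosed_closedBall
  have hφ : (fun y => Complex.ofRealCLM (χ y)) ∈ testSpaceOn M (Metric.closedBall x ε) :=
    (hχ.clm_comp Complex.ofRealCLM).mem_testSpaceOn (hsub fun y hy => by simp [hχ0 y hy])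
  have hV' : Metric.closedBall x ε ⊆ V := fun y hy => (hball hy).1
  have heq := h _ (isCompact_closedBall x ε) hV' _ hφ
  have hcpt : ∀ {p : Space d → ℂ}, Continuous p →
      Integrable fun y => p y * Complex.ofRealCLM (χ y) := fun hp =>
    (hp.mul hφ.1.continuous).integrable_of_hasCompactSupport
      ((isCompact_closedBall x ε).of_isClosed_subset (isClosed_tsupport _)
        (hsub fun y hy => by simp [hχ0 y hy]))
  have hΩ0 : ∀ y ∉ Ω, Complex.ofRealCLM (χ y) = 0 := fun y hy => by
    rw [hχ0 y fun hb => hy (hVΩ (hV' hb)), map_zero]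
  have hzero : ∫ y, w y * Complex.ofRealCLM (χ y) = 0 := by
    rw [pairing_eq_integral hΩ0, pairing_eq_integral hΩ0] at heq
    have := integral_sub (hcpt hf) (hcpt hg)
    rw [heq, sub_self] at this
    rw [← this]
    refine integral_congr_ae (Filter.Eventually.of_forall fun y => ?_)
    simp only [w]
    ring
  have hzero' : ∫ y, q y * χ y = 0 := by
    have h1 : ∫ y, starRingEnd ℂ (w x) * (w y * Complex.ofRealCLM (χ y)) = 0 := by
      rw [integral_const_mul, hzero, mul_zero]
    have h2 := integral_re ((hcpt hw).const_mul (starRingEnd ℂ (w x)))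
    rw [h1] at h2
    refine Eq.trans (integral_congr_ae (Filter.Eventually.of_forall fun y => ?_)) h2
    simp only [q, RCLike.re_to_complex, Complex.ofRealCLM_apply]
    rw [← mul_assoc, Complex.re_mul_ofReal]
  have hpos : 0 < ∫ y, q y * χ y := by
    refine (hq.mul hχ.1.continuous).integral_pos_of_hasCompactSupport_nonneg_nonzero
      ((isCompact_closedBall x ε).of_isClosed_subset (isClosed_tsupport _)
        (hsub fun y hy => by simp [hχ0 y hy])) (fun y => ?_) (x := x) ?_
    · by_cases hy : y ∈ Metric.closedBall x ε
      · exact mul_nonneg (le_of_lt (hball hy).2) (hχ01 y).1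
      · simp [hχ0 y hy]
    · rw [hχ1 x (Metric.mem_ball_self hδ), mul_one]
      exact hqx.ne'
  exact hpos.ne' hzero'

/-- Local representations by ultradifferentiable functions agree on overlaps, hence glue to a
global one. -/
theorem isUltraDiff_of_local (T : Ultradistribution M Ω)
    (h : ∀ K : CompactIn Ω, ∃ f : Space d → ℂ, IsUltra M f ∧ ∀ φ : testSpace M Ω,
      (φ : Space d → ℂ) ∈ testSpaceOn M K.1 → T.toLin φ = pairing Ω f φ) : T.IsUltraDiff := by
  classical
  choose F hF hFT using h
  have hball : ∀ x : Ω, ∃ ε : ℝ, 0 < ε ∧ Metric.closedBall (x : Space d) ε ⊆ Ω := fun x =>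
    Metric.nhds_basis_closedBall.mem_iff.1 (Ω.isOpen.mem_nhds x.2)
  choose ε hε hεΩ using hball
  let B : Ω → CompactIn Ω := fun x =>
    ⟨Metric.closedBall (x : Space d) (ε x), isCompact_closedBall _ _, hεΩ x⟩
  -- the value at `x` is read off from the representation on a ball around `x`
  let f : Space d → ℂ := fun x => if hx : x ∈ Ω then F (B ⟨x, hx⟩) x else 0
  have hagree : ∀ K : CompactIn Ω, Set.EqOn f (F K) (interior K.1) := by
    intro K x hx
    have hxΩ : x ∈ Ω := K.2.2 (interior_subset hx)
    have hfx : f x = F (B ⟨x, hxΩ⟩) x := dif_pos hxΩ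
    rw [hfx]
    refine eqOn_of_pairing_eq (M := M) (Ω := Ω) (hF _).1.continuous (hF _).1.continuous
      (V := interior K.1 ∩ Metric.ball x (ε ⟨x, hxΩ⟩)) (isOpen_interior.inter Metric.isOpen_ball)
      (fun y hy => K.2.2 (interior_subset hy.1)) (fun L hL hLV φ hφ => ?_)
      ⟨hx, Metric.mem_ball_self (hε _)⟩
    have hLK : L ⊆ K.1 := fun y hy => interior_subset (hLV hy).1
    have hLB : L ⊆ (B ⟨x, hxΩ⟩).1 := fun y hy => Metric.ball_subset_closedBall (hLV hy).2
    have hφΩ : φ ∈ testSpace M Ω := ⟨L, hL, hLK.trans K.2.2, hφ⟩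
    rw [← hFT _ ⟨φ, hφΩ⟩ (testSpaceOn_mono M hLB hφ), ← hFT K ⟨φ, hφΩ⟩ (testSpaceOn_mono M hLK hφ)]
  have hagree' : ∀ K : CompactIn Ω, ∀ x ∈ interior K.1, f =ᶠ[nhds x] F K := fun K x hx =>
    (hagree K).eventuallyEq_of_mem (isOpen_interior.mem_nhds hx)
  refine ⟨f, ⟨fun x hx => ?_, fun K hK hKΩ r hr => ?_⟩, fun φ => ?_⟩
  · have hxB : x ∈ interior (B ⟨x, hx⟩).1 :=
      Metric.ball_subset_interior_closedBall (Metric.mem_ball_self (hε _))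
    exact ((hF _).1.contDiffAt.congr_of_eventuallyEq (hagree' _ x hxB)).contDiffWithinAt
  · obtain ⟨L, hL, hKL, hLΩ⟩ := exists_compact_between hK Ω.isOpen hKΩ
    refine lt_of_le_of_lt (le_of_eq ?_) ((hF ⟨L, hL, hLΩ⟩).ultraNorm_lt_top K hr)
    unfold ultraNorm partialDeriv
    refine iSup_congr fun x => iSup_congr fun hx => iSup_congr fun α => ?_
    rw [((hagree' ⟨L, hL, hLΩ⟩ x (hKL hx)).iteratedFDeriv ℝ _).eq_of_nhds]
  · obtain ⟨K, hK, hKΩ, hφ⟩ := φ.2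
    obtain ⟨L, hL, hKL, hLΩ⟩ := exists_compact_between hK Ω.isOpen hKΩ
    rw [hFT ⟨L, hL, hLΩ⟩ φ (testSpaceOn_mono M (hKL.trans interior_subset) hφ)]
    have h0 : ∀ x ∉ K, φ.1 x = 0 := fun x hx => eq_zero_of_tsupport_subset hφ.2.1 hx
    refine integral_congr_ae (Filter.Eventually.of_forall fun x => ?_)
    by_cases hx : x ∈ K
    · simp only [hagree ⟨L, hL, hLΩ⟩ (hKL hx)]
    · simp only [h0 x hx, mul_zero]

end Roumieu

end

theorem theorem3p2 (d : ℕ) (M : Roumieu.WeightSequence)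
    (Ω : TopologicalSpace.Opens (Roumieu.Space d))
    (g : Roumieu.GenUltradistribution M Ω) (T : Roumieu.Ultradistribution M Ω)
    (k b : Roumieu.CompactIn Ω → ℕ → ℝ)
    (hreg : Roumieu.IsRegularWith g k)
    (hassoc : Roumieu.IsStronglyAssocWith g T b)
    (hbk : ∀ K i, b K i ≤ k K i) :
    T.IsUltraDiff := by
  obtain ⟨u, hu, hreg⟩ := hreg
  obtain ⟨u', hu', hassoc⟩ := hassoc
  -- the representatives in the two hypotheses may differ, but only by a negligible net
  have hmem : u - u' ∈ (Roumieu.negligible M Ω).submoduleOf (Roumieu.moderate M Ω) :=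
    (Submodule.Quotient.eq _).1 (hu.trans hu'.symm)
  have hneg : u.1 - u'.1 ∈ Roumieu.negligible M Ω := hmem
  refine Roumieu.isUltraDiff_of_local T fun K => ?_
  obtain ⟨χ, hχ, hL, hLΩ, hχ1⟩ := Roumieu.exists_cutoff M Ω.isOpen K.2.1 K.2.2
  obtain ⟨hk, hreg⟩ := hreg ⟨tsupport χ, hL, hLΩ⟩
  obtain ⟨hb, hassoc⟩ := hassoc ⟨tsupport χ, hL, hLΩ⟩
  have hassoc' := Roumieu.StrongAssocOn.congr hL hLΩ hb u.2.1 u'.2.1 hneg hassoc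
  obtain ⟨f, hf, hfT⟩ := Roumieu.exists_local_representation T u.2.1 hL hLΩ hχ subset_rfl hk hb
    (hbk _) hreg hassoc'
  have hKL : K.1 ⊆ tsupport χ := fun x hx =>
    subset_tsupport χ (by rw [Function.mem_support, hχ1 x hx]; exact one_ne_zero)
  refine ⟨f, hf, fun φ hφ => hfT φ (Roumieu.testSpaceOn_mono M hKL hφ) fun x => ?_⟩
  by_cases hx : x ∈ K.1
  · rw [hχ1 x hx, one_mul]
  · rw [Roumieu.eq_zero_of_tsupport_subset hφ.2.1 hx, mul_zero]
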